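/- **Setting.** Let $d\in\{2,3\}$ and let $\Omega\subset\mathbb R^d$ be a bounded Lipschitz domain (open and connected) with piecewise polygonal boundary. Let $\mathbf A\in L^\infty(\Omega,\mathbb R^{d\times d})$ be a.e. symmetric positive definite with $0<\alpha|\xi|^2\le (\mathbf A(x)^{-1}\xi)\cdot\xi\le\beta|\xi|^2$ for a.e. $x\in\Omega$ and all $\xi\in\mathbb R^d\setminus\{0\}$, and let $f\in L^2_0(\Omega):=\{q\in L^2(\Omega):\int_\Omega q=0\}$. Let $\mathbf H_0(\mathrm{div},\Omega)$ be the space of $\mathbf v\in L^2(\Omega,\mathbb R^d)$ with weak divergence in $L^2(\Omega)$ and vanishing normal trace on $\partial\Omega$. Put $a(\mathbf v,\mathbf w)=(\mathbf A^{-1}\mathbf v,\mathbf w)_{L^2(\Omega)}$, $b(\mathbf v,q)=(\operatorname{div}\mathbf v,q)_{L^2(\Omega)}$ and $|||\mathbf v|||=\sqrt{a(\mathbf v,\mathbf v)}$. Let $\mathcal T_H$ be a finite conforming mesh of $\overline\Omega$ by closed $d$-simplices, with $H=\max_T \operatorname{diam}T$, which is quasi-uniform, $\operatorname{diam}T\ge\gamma_{qu}H$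 for all $T$ with $\gamma_{qu}>0$, and shape-regular: each $T$ contains a ball $B$ with $\operatorname{diam}T\le\gamma_{sr}\operatorname{diam}B$. For $k\in\mathbb N_0$ let $Q_H^k$ be the space of $\mathcal T_H$-piecewise polynomials of degree at most $k$, $P_H:L^2(\Omega)\to Q_H^k$ the $L^2$-orthogonal projection, and $V_H^k$ the space of $\mathbf v\in\mathbf H_0(\mathrm{div},\Omega)$ with $\mathbf v|_T\in[\mathbb P_k(T)]^d+\boldsymbol x\,\mathbb P_k(T)$ for all $T\in\mathcal T_H$. Let $\pi_H:\mathbf H_0(\mathrm{div},\Omega)\to\mathbf H_0(\mathrm{div},\Omega)$ be a linear projection with range $V_H^k$ such that $\operatorname{div}\pi_H\mathbf v=P_H\operatorname{div}\mathbf v$ for all $\mathbf v$, and, with a constant $C_\pi$, $$\|\pi_H\mathbf v\|_{L^2(T)}^2+H^2\|\operatorname{div}\pi_H\mathbf v\|_{L^2(T)}^2\le C_\pi\big(\|\mathbf v\|_{L^2(N^1(T))}^2+H^2\|\operatorname{div}\mathbf v\|_{L^2(N^1(T))}^2\big)$$ for all $\mathbf v$ and $T\in\mathcal T_H$, where $N^1(T)$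 is the union of all elements that meet $T$. Let $W_{\operatorname{div}0}=\{\mathbf w\in\ker\pi_H:\operatorname{div}\mathbf w=0\}$. For $T\in\mathcal T_H$ and $\mathbf v\in\mathbf H_0(\mathrm{div},\Omega)$ let $\mathcal C_T\mathbf v\in W_{\operatorname{div}0}$ be defined by $a(\mathcal C_T\mathbf v,\mathbf w)=(\mathbf A^{-1}\mathbf v,\mathbf w)_{L^2(T)}$ for all $\mathbf w\in W_{\operatorname{div}0}$. Put $\mathcal C=\sum_{T\in\mathcal T_H}\mathcal C_T$, $V_H^{k,ms}=(\mathrm{id}-\mathcal C)V_H^k$ and $V_H^{k,ms}(f)=\{\mathbf v\in V_H^{k,ms}:\operatorname{div}\mathbf v=-P_Hf\}$. Let $(\mathbf u,p)\in\mathbf H_0(\mathrm{div},\Omega)\times L^2_0(\Omega)$ solve $$a(\mathbf u,\mathbf v)+b(\mathbf v,p)=0\ \ \forall\,\mathbf v\in\mathbf H_0(\mathrm{div},\Omega),\qquad b(\mathbf u,q)=-(f,q)_{L^2(\Omega)}\ \ \forall\,q\in L^2_0(\Omega),$$ and let $(\mathbf u_H^{ms},p_H)\in V_H^{k,ms}\times(Q_H^k\cap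 L^2_0(\Omega))$ solve $$a(\mathbf u_H^{ms},\mathbf v)+b(\mathbf v,p_H)=0\ \ \forall\,\mathbf v\in V_H^{k,ms},\qquad b(\mathbf u_H^{ms},q)=-(f,q)_{L^2(\Omega)}\ \ \forall\,q\in Q_H^k.$$ **Theorem.** There is a constant $C>0$ that depends only on $d,\Omega,\alpha,\beta,\gamma_{qu},\gamma_{sr},C_\pi$ (and so not on $\mathcal T_H$, $H$, $k$, $\pi_H$, $f$, or $\mathbf A$ beyond $\alpha,\beta$) such that the following hold. 1. $\mathbf u_H^{ms}\in V_H^{k,ms}(f)$ and $$|||\mathbf u-\mathbf u_H^{ms}|||=\inf_{\mathbf v\in V_H^{k,ms}(f)}|||\mathbf u-\mathbf v|||\le C\,H\,\|f-P_Hf\|_{L^2(\Omega)}.$$ 2. $$\|\operatorname{div}(\mathbf u-\mathbf u_H^{ms})\|_{L^2(\Omega)}=\inf_{q\in Q_H^k}\|\operatorname{div}\mathbf u-q\|_{L^2(\Omega)}=\|f-P_Hf\|_{L^2(\Omega)}.$$ 3. $$\|p-p_H\|_{L^2(\Omega)}\le C\big(H\|f-P_Hf\|_{L^2(\Omega)}+\|p-P_Hp\|_{L^2(\Omega)}\big).$$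 4. If $f\in Q_H^k$, then $\mathbf u=(\mathrm{id}-\mathcal C)\,\pi_H\mathbf u=\mathbf u_H^{ms}$. -/

import Mathlib

open MeasureTheory Set Topology
open scoped ContDiff

noncomputable section

namespace MixedLOD

/-! ### Lebesgue spaces on an open subset of Euclidean space -/

/-- Euclidean space `ℝᵈ`. -/
abbrev Euc (d : ℕ) : Type := EuclideanSpace ℝ (Fin d)

variable {d : ℕ}

/-- The real Hilbert space `L²(Ω)`. -/
abbrev L2 (Ω : TopologicalSpace.Opens (Euc d)) : Type :=
  Lp ℝ 2 (volume.restrict (Ω : Set (Euc d)))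

/-- The real Hilbert space `L²(Ω, ℝᵈ)`. -/
abbrev L2Vec (Ω : TopologicalSpace.Opens (Euc d)) : Type :=
  Lp (Euc d) 2 (volume.restrict (Ω : Set (Euc d)))

/-- The set `L²₀(Ω)` of square-integrable functions with mean zero. -/
def L2Zero (Ω : TopologicalSpace.Opens (Euc d)) : Set (L2 Ω) :=
  {q | ∫ x in (Ω : Set (Euc d)), q x = 0}

/-- A bounded Lipschitz domain: nonempty, open, connected, bounded, and near each boundary point,
in suitable orthonormal coordinates, the strict epigraph of a Lipschitz function. The coordinate
in the direction of the unit vector `e` is `⟪e, x⟫`, the others are those of `x - ⟪e, x⟫ e`. -/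
structure IsBoundedLipschitzDomain (Ω : TopologicalSpace.Opens (Euc d)) : Prop where
  isConnected : IsConnected (Ω : Set (Euc d))
  isBounded : Bornology.IsBounded (Ω : Set (Euc d))
  lipschitz_boundary : ∀ x₀ ∈ frontier (Ω : Set (Euc d)),
    ∃ e : Euc d, ‖e‖ = 1 ∧ ∃ (K : NNReal) (g : Euc d → ℝ), LipschitzWith K g ∧
      ∃ U ∈ 𝓝 x₀, ∀ x ∈ U, x ∈ Ω ↔ g (x - (inner ℝ e x) • e) < inner ℝ e x

/-! ### The spaces `H(div, Ω)` and `H₀(div, Ω)` -/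

section HDiv

variable (Ω : TopologicalSpace.Opens (Euc d))

/-- `g` is the weak divergence of `v` in `Ω`: `∫ v · ∇φ = - ∫ g φ` for all `φ ∈ C_c^∞(Ω)`.
Here `v · ∇φ` is written as `Dφ(x)(v(x))`. -/
def HasWeakDiv (v : L2Vec Ω) (g : L2 Ω) : Prop :=
  ∀ φ : Euc d → ℝ, ContDiff ℝ ∞ φ → HasCompactSupport φ → tsupport φ ⊆ (Ω : Set (Euc d)) →
    ∫ x in (Ω : Set (Euc d)), fderiv ℝ φ x (v x) = - ∫ x in (Ω : Set (Euc d)), g x * φ x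

variable {Ω}

theorem integrable_fderiv_apply (v : L2Vec Ω) {φ : Euc d → ℝ} (hφ : ContDiff ℝ ∞ φ)
    (hc : HasCompactSupport φ) :
    Integrable (fun x => fderiv ℝ φ x (v x)) (volume.restrict (Ω : Set (Euc d))) := by
  have hcont : Continuous (fderiv ℝ φ) := hφ.continuous_fderiv (by simp)
  have h1 : MemLp (fderiv ℝ φ) 2 (volume.restrict (Ω : Set (Euc d))) :=
    (hcont.memLp_of_hasCompactSupport (hc.fderiv (𝕜 := ℝ))).restrict _
  have h2 : MemLp (v : Euc d → Euc d) 2 (volume.restrict (Ω : Set (Euc d))) := Lp.memLp v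
  have h3 : Integrable (fun x => ‖fderiv ℝ φ x‖ * ‖v x‖) (volume.restrict (Ω : Set (Euc d))) :=
    h1.norm.integrable_mul h2.norm
  refine Integrable.mono' h3 ?_ ?_
  · exact (ContinuousLinearMap.id ℝ (Euc d →L[ℝ] ℝ)).aestronglyMeasurable_comp₂ h1.1 h2.1
  · exact Filter.Eventually.of_forall fun x => (fderiv ℝ φ x).le_opNorm (v x)

theorem integrable_mul_test (g : L2 Ω) {φ : Euc d → ℝ} (hφ : ContDiff ℝ ∞ φ)
    (hc : HasCompactSupport φ) :
    Integrable (fun x => g x * φ x) (volume.restrict (Ω : Set (Euc d))) := by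
  have h : MemLp φ 2 (volume.restrict (Ω : Set (Euc d))) :=
    (hφ.continuous.memLp_of_hasCompactSupport hc).restrict _
  exact (Lp.memLp g).integrable_mul h

theorem integral_fderiv_add (v w : L2Vec Ω) {φ : Euc d → ℝ} (hφ : ContDiff ℝ ∞ φ)
    (hc : HasCompactSupport φ) :
    ∫ x in (Ω : Set (Euc d)), fderiv ℝ φ x ((v + w : L2Vec Ω) x)
      = (∫ x in (Ω : Set (Euc d)), fderiv ℝ φ x (v x))
        + ∫ x in (Ω : Set (Euc d)), fderiv ℝ φ x (w x) := by
  rw [← integral_add (integrable_fderiv_apply v hφ hc) (integrable_fderiv_apply w hφ hc)]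
  refine integral_congr_ae ?_
  filter_upwards [Lp.coeFn_add v w] with x hx
  rw [hx, Pi.add_apply, map_add]

theorem integral_fderiv_smul (c : ℝ) (v : L2Vec Ω) (φ : Euc d → ℝ) :
    ∫ x in (Ω : Set (Euc d)), fderiv ℝ φ x ((c • v : L2Vec Ω) x)
      = c * ∫ x in (Ω : Set (Euc d)), fderiv ℝ φ x (v x) := by
  rw [← integral_const_mul]
  refine integral_congr_ae ?_
  filter_upwards [Lp.coeFn_smul c v] with x hx
  simp [hx]

theorem integral_mul_add (g h : L2 Ω) {φ : Euc d → ℝ} (hφ : ContDiff ℝ ∞ φ)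
    (hc : HasCompactSupport φ) :
    ∫ x in (Ω : Set (Euc d)), (g + h : L2 Ω) x * φ x
      = (∫ x in (Ω : Set (Euc d)), g x * φ x) + ∫ x in (Ω : Set (Euc d)), h x * φ x := by
  rw [← integral_add (integrable_mul_test g hφ hc) (integrable_mul_test h hφ hc)]
  refine integral_congr_ae ?_
  filter_upwards [Lp.coeFn_add g h] with x hx
  rw [hx, Pi.add_apply, add_mul]

theorem integral_mul_smul (c : ℝ) (g : L2 Ω) (φ : Euc d → ℝ) :
    ∫ x in (Ω : Set (Euc d)), (c • g : L2 Ω) x * φ x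
      = c * ∫ x in (Ω : Set (Euc d)), g x * φ x := by
  rw [← integral_const_mul]
  refine integral_congr_ae ?_
  filter_upwards [Lp.coeFn_smul c g] with x hx
  simp [hx, mul_assoc]

theorem HasWeakDiv.add {v w : L2Vec Ω} {g h : L2 Ω} (hv : HasWeakDiv Ω v g)
    (hw : HasWeakDiv Ω w h) : HasWeakDiv Ω (v + w) (g + h) := by
  intro φ hφ hc hs
  rw [integral_fderiv_add v w hφ hc, integral_mul_add g h hφ hc, hv φ hφ hc hs, hw φ hφ hc hs]
  ring

theorem HasWeakDiv.smul (c : ℝ) {v : L2Vec Ω} {g : L2 Ω} (hv : HasWeakDiv Ω v g) :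
    HasWeakDiv Ω (c • v) (c • g) := by
  intro φ hφ hc hs
  rw [integral_fderiv_smul, integral_mul_smul, hv φ hφ hc hs]
  ring

theorem HasWeakDiv.zero : HasWeakDiv Ω 0 0 := by
  intro φ hφ hc hs
  have h1 := integral_fderiv_smul (0 : ℝ) (0 : L2Vec Ω) φ
  have h2 := integral_mul_smul (0 : ℝ) (0 : L2 Ω) φ
  rw [zero_smul, zero_mul] at h1 h2
  rw [h1, h2, neg_zero]

theorem HasWeakDiv.unique {v : L2Vec Ω} {g h : L2 Ω} (hg : HasWeakDiv Ω v g)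
    (hh : HasWeakDiv Ω v h) : g = h := by
  have key : HasWeakDiv Ω 0 (g + (-1 : ℝ) • h) := by
    have := hg.add (hh.smul (-1))
    simpa using this
  have hloc : LocallyIntegrableOn ((g + (-1 : ℝ) • h : L2 Ω) : Euc d → ℝ) (Ω : Set (Euc d))
      volume := by
    exact locallyIntegrableOn_of_locallyIntegrable_restrict
      ((Lp.memLp (g + (-1 : ℝ) • h)).locallyIntegrable (by norm_num))
  have hz := Ω.isOpen.ae_eq_zero_of_integral_contDiff_smul_eq_zero hloc (by
    intro φ hφ hc hs
    have h0 := key φ hφ hc hs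
    have h1 := integral_fderiv_smul (0 : ℝ) (0 : L2Vec Ω) φ
    rw [zero_smul, zero_mul] at h1
    rw [h1] at h0
    have h2 : ∫ x, φ x • ((g + (-1 : ℝ) • h : L2 Ω) : Euc d → ℝ) x
        = ∫ x in (Ω : Set (Euc d)), ((g + (-1 : ℝ) • h : L2 Ω) : Euc d → ℝ) x * φ x := by
      rw [setIntegral_eq_integral_of_forall_compl_eq_zero]
      · simp [mul_comm]
      · intro x hx
        have : φ x = 0 := image_eq_zero_of_notMem_tsupport fun hx' => hx (hs hx')
        simp [this]
    rw [h2]; linarith)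
  have hz' : (g + (-1 : ℝ) • h : L2 Ω) = 0 := by
    rw [Lp.eq_zero_iff_ae_eq_zero]
    rw [Filter.EventuallyEq, ae_restrict_iff' Ω.isOpen.measurableSet]
    exact hz
  rw [neg_one_smul, add_neg_eq_zero] at hz'
  exact hz'

variable (Ω)

/-- `H(div, Ω)`: the vector fields in `L²(Ω, ℝᵈ)` with a weak divergence in `L²(Ω)`. -/
def HDiv : Submodule ℝ (L2Vec Ω) where
  carrier := {v | ∃ g : L2 Ω, HasWeakDiv Ω v g}
  add_mem' := fun ⟨g, hg⟩ ⟨h, hh⟩ => ⟨g + h, hg.add hh⟩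
  zero_mem' := ⟨0, HasWeakDiv.zero⟩
  smul_mem' := fun c _ ⟨g, hg⟩ => ⟨c • g, hg.smul c⟩

/-- The weak divergence as a linear operator on `H(div, Ω)`. -/
def weakDiv : HDiv Ω →ₗ[ℝ] L2 Ω where
  toFun v := v.2.choose
  map_add' v w := (v + w).2.choose_spec.unique (v.2.choose_spec.add w.2.choose_spec)
  map_smul' c v := (c • v).2.choose_spec.unique (v.2.choose_spec.smul c)

theorem hasWeakDiv_weakDiv (v : HDiv Ω) : HasWeakDiv Ω v (weakDiv Ω v) := v.2.choose_spec

/-- `H₀(div, Ω)`: the fields in `H(div, Ω)` with vanishing normal trace on `∂Ω`. The normal trace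
of `v ∈ H(div, Ω)` is the functional given by Green's formula,
`⟨v · n, φ⟩ = ∫_Ω v · ∇φ + ∫_Ω (div v) φ`, on (the traces of) the functions `φ` that are smooth up
to the boundary of `Ω`. -/
def H0Div : Submodule ℝ (HDiv Ω) where
  carrier := {v | ∀ φ : Euc d → ℝ, ContDiff ℝ ∞ φ → HasCompactSupport φ →
    (∫ x in (Ω : Set (Euc d)), fderiv ℝ φ x ((v : L2Vec Ω) x))
      + ∫ x in (Ω : Set (Euc d)), weakDiv Ω v x * φ x = 0}
  add_mem' := by
    intro v w hv hw φ hφ hc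
    have h1 := hv φ hφ hc
    have h2 := hw φ hφ hc
    rw [map_add, Submodule.coe_add, integral_fderiv_add _ _ hφ hc, integral_mul_add _ _ hφ hc]
    linarith
  zero_mem' := by
    intro φ _ _
    have h1 := integral_fderiv_smul (0 : ℝ) (0 : L2Vec Ω) φ
    have h2 := integral_mul_smul (0 : ℝ) (0 : L2 Ω) φ
    rw [zero_smul, zero_mul] at h1 h2
    rw [map_zero, Submodule.coe_zero, h1, h2, add_zero]
  smul_mem' := by
    intro c v hv φ hφ hc
    have h1 := hv φ hφ hc
    rw [map_smul, Submodule.coe_smul, integral_fderiv_smul, integral_mul_smul, ← mul_add, h1,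
      mul_zero]

/-- The underlying `L²` vector field of an element of `H₀(div, Ω)`. -/
def toL2 : H0Div Ω →ₗ[ℝ] L2Vec Ω := (HDiv Ω).subtype ∘ₗ (H0Div Ω).subtype

/-- The divergence on `H₀(div, Ω)`. -/
def divergence : H0Div Ω →ₗ[ℝ] L2 Ω := weakDiv Ω ∘ₗ (H0Div Ω).subtype

/-- The square of the `L²`-norm of `f` over the part of `Ω` in the set `T`. -/
def normSqOn {F : Type*} [NormedAddCommGroup F] {Ω : TopologicalSpace.Opens (Euc d)}
    (f : Lp F 2 (volume.restrict (Ω : Set (Euc d)))) (T : Set (Euc d)) : ℝ :=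
  ∫ x in T ∩ (Ω : Set (Euc d)), ‖f x‖ ^ 2

end HDiv

/-! ### The mixed problem -/

section Mixed

variable {Ω : TopologicalSpace.Opens (Euc d)}

/-- `A` is a measurable, a.e. symmetric positive definite coefficient on `Ω` for which the
spectrum of `A⁻¹` lies a.e. in `[α, β]`. (For `α > 0` this gives `A ∈ L^∞`, with `|A| ≤ 1 / α`.) -/
structure IsCoefficient (Ω : TopologicalSpace.Opens (Euc d)) (α β : ℝ)
    (A : Euc d → Matrix (Fin d) (Fin d) ℝ) : Prop where
  aemeasurable : ∀ i j, AEMeasurable (fun x => A x i j) (volume.restrict (Ω : Set (Euc d)))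
  posDef : ∀ᵐ x ∂(volume.restrict (Ω : Set (Euc d))), (A x).PosDef
  bounds : ∀ᵐ x ∂(volume.restrict (Ω : Set (Euc d))), ∀ ξ : Euc d,
    α * ‖ξ‖ ^ 2 ≤ inner ℝ (Matrix.toEuclideanLin (A x)⁻¹ ξ) ξ ∧
      inner ℝ (Matrix.toEuclideanLin (A x)⁻¹ ξ) ξ ≤ β * ‖ξ‖ ^ 2

/-- The bilinear form `a_T(v, w) = (A⁻¹ v, w)_{L²(T)}`, for the part of `Ω` in the set `T`. -/
def aOn (A : Euc d → Matrix (Fin d) (Fin d) ℝ) (T : Set (Euc d)) (v w : H0Div Ω) : ℝ :=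
  ∫ x in T ∩ (Ω : Set (Euc d)),
    inner ℝ (Matrix.toEuclideanLin (A x)⁻¹ (toL2 Ω v x)) (toL2 Ω w x)

/-- The bilinear form `a(v, w) = (A⁻¹ v, w)_{L²(Ω)}`. -/
def aForm (A : Euc d → Matrix (Fin d) (Fin d) ℝ) (v w : H0Div Ω) : ℝ :=
  ∫ x in (Ω : Set (Euc d)), inner ℝ (Matrix.toEuclideanLin (A x)⁻¹ (toL2 Ω v x)) (toL2 Ω w x)

/-- The bilinear form `b(v, q) = (div v, q)_{L²(Ω)}`. -/
def bForm (v : H0Div Ω) (q : L2 Ω) : ℝ := inner ℝ (divergence Ω v) q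

/-- The energy norm `|||v||| = a(v, v)^{1/2}`. -/
def energyNorm (A : Euc d → Matrix (Fin d) (Fin d) ℝ) (v : H0Div Ω) : ℝ := √(aForm A v v)

/-- `(u, p) ∈ H₀(div, Ω) × L²₀(Ω)` solves the mixed problem with source `f`. -/
structure IsMixedSolution (A : Euc d → Matrix (Fin d) (Fin d) ℝ) (f : L2 Ω)
    (u : H0Div Ω) (p : L2 Ω) : Prop where
  mean_zero : p ∈ L2Zero Ω
  flux : ∀ v : H0Div Ω, aForm A u v + bForm v p = 0
  mass : ∀ q ∈ L2Zero Ω, bForm u q = - inner ℝ f q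

end Mixed

/-! ### Meshes and Raviart-Thomas spaces -/

/-- A conforming simplicial mesh of `Ω`: finitely many nondegenerate closed `d`-simplices (given
by their vertex sets) that cover the closure of `Ω` and such that the intersection of any two of
them is the simplex spanned by the common vertices (and hence empty or a common subsimplex). -/
structure SimplicialMesh (Ω : TopologicalSpace.Opens (Euc d)) where
  cells : Finset (Finset (Euc d))
  affineIndependent : ∀ s ∈ cells, AffineIndependent ℝ ((↑) : s → Euc d)
  card_eq : ∀ s ∈ cells, s.card = d + 1
  conforming : ∀ s ∈ cells, ∀ t ∈ cells,
    convexHull ℝ (s : Set (Euc d)) ∩ convexHull ℝ (t : Set (Euc d))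
      = convexHull ℝ ((s : Set (Euc d)) ∩ (t : Set (Euc d)))
  covers : ⋃ s ∈ cells, convexHull ℝ (s : Set (Euc d)) = closure (Ω : Set (Euc d))

/-- The closed simplex with vertex set `s`. -/
def simplex (s : Finset (Euc d)) : Set (Euc d) := convexHull ℝ (s : Set (Euc d))

namespace SimplicialMesh

variable {Ω : TopologicalSpace.Opens (Euc d)} (M : SimplicialMesh Ω)

/-- The mesh size `H = max_T diam T`. -/
def H : ℝ := ⨆ s : M.cells, Metric.diam (simplex s.1)

/-- Quasi-uniformity, `min_T H_T ≥ γ H`. -/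
def IsQuasiUniform (γ : ℝ) : Prop := ∀ s ∈ M.cells, γ * M.H ≤ Metric.diam (simplex s)

/-- Shape regularity: every element `T` contains a ball `B` with `diam T ≤ γ diam B`. -/
def IsShapeRegular (γ : ℝ) : Prop := ∀ s ∈ M.cells, ∃ (x : Euc d) (r : ℝ), 0 < r ∧
  Metric.closedBall x r ⊆ simplex s ∧ Metric.diam (simplex s) ≤ γ * (2 * r)

/-- The element patch `N¹(T)`, the union of all elements that meet `T`. -/
def patch (s : Finset (Euc d)) : Set (Euc d) :=
  ⋃ t ∈ M.cells, ⋃ (_ : (simplex t ∩ simplex s).Nonempty), simplex t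

/-- The space `Q_H^k` of piecewise polynomials of (total) degree at most `k`. -/
def Q (k : ℕ) : Submodule ℝ (L2 Ω) where
  carrier := {q | ∀ s ∈ M.cells, ∃ P ∈ MvPolynomial.restrictTotalDegree (Fin d) ℝ k,
    ∀ᵐ x ∂(volume.restrict (Ω : Set (Euc d))), x ∈ simplex s →
      q x = MvPolynomial.eval (x : Fin d → ℝ) P}
  add_mem' := by
    intro q r hq hr s hs
    obtain ⟨P, hP, h1⟩ := hq s hs
    obtain ⟨R, hR, h2⟩ := hr s hs
    refine ⟨P + R, Submodule.add_mem _ hP hR, ?_⟩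
    filter_upwards [h1, h2, Lp.coeFn_add q r] with x hx1 hx2 hx hxs
    rw [hx, Pi.add_apply, hx1 hxs, hx2 hxs, map_add]
  zero_mem' := by
    intro s hs
    refine ⟨0, Submodule.zero_mem _, ?_⟩
    filter_upwards [Lp.coeFn_zero ℝ 2 (volume.restrict (Ω : Set (Euc d)))] with x hx _
    rw [hx, Pi.zero_apply, map_zero]
  smul_mem' := by
    intro c q hq s hs
    obtain ⟨P, hP, h1⟩ := hq s hs
    refine ⟨c • P, Submodule.smul_mem _ c hP, ?_⟩
    filter_upwards [h1, Lp.coeFn_smul c q] with x hx1 hx hxs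
    simp [hx, hx1 hxs]

/-- A vector field in the space `RT_k = [P_k]^d + x P_k` of Raviart-Thomas shape functions. -/
def rtField (P : Fin d → MvPolynomial (Fin d) ℝ) (R : MvPolynomial (Fin d) ℝ) (x : Euc d) :
    Euc d :=
  WithLp.toLp 2 fun i =>
    MvPolynomial.eval (x : Fin d → ℝ) (P i) + x i * MvPolynomial.eval (x : Fin d → ℝ) R

/-- The piecewise Raviart-Thomas space `RT_k(T_H)`. -/
def RT (k : ℕ) : Submodule ℝ (L2Vec Ω) where
  carrier := {v | ∀ s ∈ M.cells, ∃ (P : Fin d → MvPolynomial (Fin d) ℝ)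
    (R : MvPolynomial (Fin d) ℝ),
    (∀ i, P i ∈ MvPolynomial.restrictTotalDegree (Fin d) ℝ k) ∧
    R ∈ MvPolynomial.restrictTotalDegree (Fin d) ℝ k ∧
    ∀ᵐ x ∂(volume.restrict (Ω : Set (Euc d))), x ∈ simplex s → v x = rtField P R x}
  add_mem' := by
    intro v w hv hw s hs
    obtain ⟨P, R, hP, hR, h1⟩ := hv s hs
    obtain ⟨P', R', hP', hR', h2⟩ := hw s hs
    refine ⟨P + P', R + R', fun i => Submodule.add_mem _ (hP i) (hP' i),
      Submodule.add_mem _ hR hR', ?_⟩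
    filter_upwards [h1, h2, Lp.coeFn_add v w] with x hx1 hx2 hx hxs
    rw [hx, Pi.add_apply, hx1 hxs, hx2 hxs]
    ext i
    simp [rtField]
    ring
  zero_mem' := by
    intro s hs
    refine ⟨0, 0, fun _ => Submodule.zero_mem _, Submodule.zero_mem _, ?_⟩
    filter_upwards [Lp.coeFn_zero (Euc d) 2 (volume.restrict (Ω : Set (Euc d)))] with x hx _
    rw [hx]
    ext i
    simp [rtField]
  smul_mem' := by
    intro c v hv s hs
    obtain ⟨P, R, hP, hR, h1⟩ := hv s hs
    refine ⟨c • P, c • R, fun i => Submodule.smul_mem _ c (hP i), Submodule.smul_mem _ c hR, ?_⟩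
    filter_upwards [h1, Lp.coeFn_smul c v] with x hx1 hx hxs
    rw [hx, Pi.smul_apply, hx1 hxs]
    ext i
    simp [rtField]
    ring

/-- The Raviart-Thomas space `V_H^k = RT_k(T_H) ∩ H₀(div, Ω)`. -/
def V (k : ℕ) : Submodule ℝ (H0Div Ω) := (M.RT k).comap (toL2 Ω)

/-- Pairs of an `L²` function and polynomials that represent it on the elements of the mesh. -/
def polyPairs (k : ℕ) :
    Submodule ℝ (L2 Ω × (M.cells → MvPolynomial.restrictTotalDegree (Fin d) ℝ k)) where
  carrier := {z | ∀ s : M.cells, ∀ᵐ x ∂(volume.restrict (Ω : Set (Euc d))),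
    x ∈ simplex s.1 → z.1 x = MvPolynomial.eval (x : Fin d → ℝ) (z.2 s).1}
  add_mem' := by
    intro z w hz hw s
    filter_upwards [hz s, hw s, Lp.coeFn_add z.1 w.1] with x hx1 hx2 hx hxs
    rw [Prod.fst_add, hx, Pi.add_apply, hx1 hxs, hx2 hxs, ← map_add]
    rfl
  zero_mem' := by
    intro s
    filter_upwards [Lp.coeFn_zero ℝ 2 (volume.restrict (Ω : Set (Euc d)))] with x hx _
    rw [Prod.fst_zero, hx, Pi.zero_apply]
    exact (map_zero _).symm
  smul_mem' := by
    intro c z hz s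
    filter_upwards [hz s, Lp.coeFn_smul c z.1] with x hx1 hx hxs
    simp [hx, hx1 hxs]

instance finiteDimensional_polyPairs (k : ℕ) : FiniteDimensional ℝ (M.polyPairs k) := by
  refine FiniteDimensional.of_injective
    ((LinearMap.snd ℝ (L2 Ω) (M.cells → MvPolynomial.restrictTotalDegree (Fin d) ℝ k)) ∘ₗ
      (M.polyPairs k).subtype) ((injective_iff_map_eq_zero _).2 ?_)
  rintro ⟨⟨q, P⟩, hz⟩ h0
  have hP : P = 0 := h0
  subst hP
  have hall : ∀ᵐ x ∂(volume.restrict (Ω : Set (Euc d))), ∀ s : M.cells,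
      x ∈ simplex s.1 → q x = 0 := by
    rw [ae_all_iff]
    intro s
    filter_upwards [hz s] with x hx hxs
    simpa using hx hxs
  have hq : q = 0 := by
    rw [Lp.eq_zero_iff_ae_eq_zero]
    filter_upwards [hall, ae_restrict_mem Ω.isOpen.measurableSet] with x hx hxΩ
    have hmem : x ∈ ⋃ s ∈ M.cells, convexHull ℝ (s : Set (Euc d)) := by
      rw [M.covers]
      exact subset_closure hxΩ
    simp only [mem_iUnion] at hmem
    obtain ⟨s, hs, hxs⟩ := hmem
    exact hx ⟨s, hs⟩ hxs
  subst hq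
  rfl

instance finiteDimensional_Q (k : ℕ) : FiniteDimensional ℝ (M.Q k) := by
  have h : M.Q k ≤ (M.polyPairs k).map (LinearMap.fst ℝ (L2 Ω)
      (M.cells → MvPolynomial.restrictTotalDegree (Fin d) ℝ k)) := by
    intro q hq
    choose P hP hx using hq
    exact ⟨(q, fun s => ⟨P s.1 s.2, hP s.1 s.2⟩), fun s => hx s.1 s.2, rfl⟩
  exact Submodule.finiteDimensional_of_le h

/-- The `L²`-orthogonal projection `P_H` onto `Q_H^k`. -/
def projQ (k : ℕ) : L2 Ω →L[ℝ] L2 Ω := (M.Q k).starProjection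

/-! ### Quasi-interpolation, correctors and the ideal multiscale method -/

/-- `π` is a stable quasi-interpolation operator onto `V_H^k` with stability constant `C`:
a linear projection of `H₀(div, Ω)` onto `V_H^k` that is locally stable and satisfies
`div ∘ π = P_H ∘ div`. -/
structure IsStableQuasiInterpolation (k : ℕ) (C : ℝ) (π : H0Div Ω →ₗ[ℝ] H0Div Ω) : Prop where
  stable : ∀ v : H0Div Ω, ∀ s ∈ M.cells,
    normSqOn (toL2 Ω (π v)) (simplex s) + M.H ^ 2 * normSqOn (divergence Ω (π v)) (simplex s)
      ≤ C * (normSqOn (toL2 Ω v) (M.patch s) + M.H ^ 2 * normSqOn (divergence Ω v) (M.patch s))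
  range_eq : LinearMap.range π = M.V k
  idem : ∀ v : H0Div Ω, π (π v) = π v
  commuting : ∀ v : H0Div Ω, divergence Ω (π v) = M.projQ k (divergence Ω v)

end SimplicialMesh

section Ideal

variable {Ω : TopologicalSpace.Opens (Euc d)}

/-- `W_{div 0}`: the divergence-free fields in `H₀(div, Ω)` in the kernel of `π`. -/
def WDivZero (π : H0Div Ω →ₗ[ℝ] H0Div Ω) : Submodule ℝ (H0Div Ω) :=
  LinearMap.ker π ⊓ LinearMap.ker (divergence Ω)

open Classical in
/-- The ideal element corrector `C_T v`, for `T` the simplex `s`: the element of `W_{div 0}` with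
`a(C_T v, w) = a_T(v, w)` for all `w ∈ W_{div 0}`. (The value `0` is never used for a coefficient
and a quasi-interpolation operator as above, by the Lax-Milgram theorem.) -/
def elementCorrector (A : Euc d → Matrix (Fin d) (Fin d) ℝ) (π : H0Div Ω →ₗ[ℝ] H0Div Ω)
    (s : Finset (Euc d)) (v : H0Div Ω) : H0Div Ω :=
  if h : ∃ z ∈ WDivZero π, ∀ w ∈ WDivZero π, aForm A z w = aOn A (simplex s) v w then h.choose else 0

/-- The ideal global corrector `C = ∑_T C_T`. -/
def corrector (M : SimplicialMesh Ω) (A : Euc d → Matrix (Fin d) (Fin d) ℝ)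
    (π : H0Div Ω →ₗ[ℝ] H0Div Ω) (v : H0Div Ω) : H0Div Ω :=
  ∑ s ∈ M.cells, elementCorrector A π s v

/-- The ideal multiscale space `V_H^{k,ms} = (id - C) V_H^k`. -/
def Vms (M : SimplicialMesh Ω) (k : ℕ) (A : Euc d → Matrix (Fin d) (Fin d) ℝ)
    (π : H0Div Ω →ₗ[ℝ] H0Div Ω) : Set (H0Div Ω) :=
  (fun v => v - corrector M A π v) '' (M.V k : Set (H0Div Ω))

/-- The affine space `V_H^{k,ms}(f)` of all `v ∈ V_H^{k,ms}` with `div v = - P_H f`. -/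
def VmsOf (M : SimplicialMesh Ω) (k : ℕ) (A : Euc d → Matrix (Fin d) (Fin d) ℝ)
    (π : H0Div Ω →ₗ[ℝ] H0Div Ω) (f : L2 Ω) : Set (H0Div Ω) :=
  {v | v ∈ Vms M k A π ∧ divergence Ω v = - M.projQ k f}

/-- `(uH, pH) ∈ V_H^{k,ms} × (Q_H^k ∩ L²₀(Ω))` solves the ideal multiscale problem. -/
structure IsIdealSolution (M : SimplicialMesh Ω) (k : ℕ)
    (A : Euc d → Matrix (Fin d) (Fin d) ℝ) (π : H0Div Ω →ₗ[ℝ] H0Div Ω) (f : L2 Ω)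
    (uH : H0Div Ω) (pH : L2 Ω) : Prop where
  flux_mem : uH ∈ Vms M k A π
  pressure_mem : pH ∈ M.Q k
  mean_zero : pH ∈ L2Zero Ω
  flux : ∀ v ∈ Vms M k A π, aForm A uH v + bForm v pH = 0
  mass : ∀ q ∈ M.Q k, bForm uH q = - inner ℝ f q

end Ideal

end MixedLOD

end

open MixedLOD

namespace MixedLOD

section

/-! ### The Poincaré inequality on convex sets -/

/-! The corrector is the `a`-orthogonal projection onto `WDivZero π` (`bilin_corrector`).
Subtracting it therefore changes neither the divergence nor the image under `π`, cannot increase the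
energy, and makes every field of `Vms` `a`-orthogonal to `WDivZero π`. Galerkin orthogonality makes
`uH` the best approximation of `u` among the fields with the prescribed divergence, so it suffices
to estimate `e = u - (π u - corrector M A π (π u))`.

Put `g = f - M.projQ k f`. Then `π e = 0`, `div e = -g`, and `e` is `a`-orthogonal to `WDivZero π`.
If `div z = g`, then `e + (z - π z)` lies in `WDivZero π`, since `div (π z)` is the projection of
`g`, which vanishes. Hence `a(e, e) = a(e, π z - z)`, and the energy of `e` is at most that of `π z
- z` (`energyNorm_sub_interpolation_le`). As `g` has mean zero on every element, `z` can be chosen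
of size `H ‖g‖`; this is the only source of the factor `H`. For `f` in `Q_H^k` the bound is zero,
which gives the exactness assertion.

For the pressure, each mean-zero `q` in `Q_H^k` is the divergence of some `π z - corrector M A π (π
z)` with controlled energy (`exists_mem_Vms_divergence_eq`). This is the inf-sup condition, and
subtracting the two flux equations concludes (`norm_projQ_sub_le`).

The fields `z` come from duality: a bound of `(g, φ)` by the norm of the gradient of `φ` gives, by
Hahn-Banach and Riesz, a field with divergence `g` and zero normal trace. Such bounds are Poincaré
inequalities, on each simplex with constant of order `H²`, and on `Ω` by gluing convex pieces.
Constants are uniform in the mesh because the element patches overlap boundedly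
(`card_neighbours_le`). -/

theorem sq_intervalIntegral_le {h : ℝ → ℝ} (hh : Continuous h) :
    (∫ t in (0 : ℝ)..1, h t) ^ 2 ≤ ∫ t in (0 : ℝ)..1, h t ^ 2 := by
  set m := ∫ t in (0 : ℝ)..1, h t with hm
  have h0 : 0 ≤ ∫ t in (0 : ℝ)..1, (h t - m) ^ 2 :=
    intervalIntegral.integral_nonneg (by norm_num) fun t _ => sq_nonneg _
  have h1 : ∀ t, (h t - m) ^ 2 = h t ^ 2 - 2 * m * h t + m ^ 2 := fun t => by ring
  simp_rw [h1] at h0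
  rw [intervalIntegral.integral_add, intervalIntegral.integral_sub,
    intervalIntegral.integral_const_mul, ← hm] at h0
  · simp at h0
    nlinarith
  all_goals exact Continuous.intervalIntegrable (by fun_prop) _ _

/-- The squared increment of a smooth function is bounded by an integral along the segment. -/
theorem sq_sub_le_integral_segment {E : Type*} [NormedAddCommGroup E] [NormedSpace ℝ E]
    {φ : E → ℝ} (hφ : ContDiff ℝ 1 φ) (x y : E) :
    (φ y - φ x) ^ 2
      ≤ dist x y ^ 2 * ∫ t in (0 : ℝ)..1, ‖fderiv ℝ φ ((1 - t) • x + t • y)‖ ^ 2 := by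
  have hc : Continuous (fderiv ℝ φ) := hφ.continuous_fderiv (by simp)
  have hγ : ∀ t : ℝ, HasDerivAt (fun t : ℝ => (1 - t) • x + t • y) (y - x) t := by
    intro t
    have h1 : HasDerivAt (fun t : ℝ => (1 - t) • x) ((-1 : ℝ) • x) t :=
      ((hasDerivAt_id t).const_sub 1).smul_const x
    have h2 : HasDerivAt (fun t : ℝ => t • y) ((1 : ℝ) • y) t := (hasDerivAt_id t).smul_const y
    have h3 := h1.add h2
    rwa [neg_one_smul, one_smul, neg_add_eq_sub] at h3
  have hd : ∀ t : ℝ, HasDerivAt (fun t : ℝ => φ ((1 - t) • x + t • y))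
      (fderiv ℝ φ ((1 - t) • x + t • y) (y - x)) t := fun t =>
    ((hφ.differentiable (by simp) _).hasFDerivAt).comp_hasDerivAt t (hγ t)
  have hcont : Continuous fun t : ℝ => fderiv ℝ φ ((1 - t) • x + t • y) (y - x) := by fun_prop
  have hftc := intervalIntegral.integral_eq_sub_of_hasDerivAt (a := 0) (b := 1)
    (fun t _ => hd t) (hcont.intervalIntegrable _ _)
  simp only [sub_self, zero_smul, one_smul, zero_add, sub_zero, add_zero] at hftc
  rw [← hftc, ← intervalIntegral.integral_const_mul]
  refine (sq_intervalIntegral_le hcont).trans ?_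
  refine intervalIntegral.integral_mono_on (by norm_num)
    (Continuous.intervalIntegrable (by fun_prop) _ _)
    (Continuous.intervalIntegrable (by fun_prop) _ _) fun t _ => ?_
  rw [← mul_pow, dist_comm, dist_eq_norm, mul_comm, ← sq_abs]
  gcongr
  exact (fderiv ℝ φ _).le_opNorm _

variable {d : ℕ}

/-- Integrals over the image of a convex set under a homothety. -/
theorem setLIntegral_comp_homothety_le {K : Set (Euc d)} (hK : Convex ℝ K)
    (hKm : MeasurableSet K) {h : Euc d → ENNReal} (hh : Measurable h) {y : Euc d} (hy : y ∈ K)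
    {t : ℝ} (ht : t ∈ Icc (1 / 2 : ℝ) 1) :
    ∫⁻ x in K, h ((1 - t) • y + t • x) ≤ 2 ^ d * ∫⁻ x in K, h x := by
  have ht0 : (0 : ℝ) < t := lt_of_lt_of_le (by norm_num) ht.1
  have hi : Measurable (K.indicator h) := hh.indicator hKm
  calc ∫⁻ x in K, h ((1 - t) • y + t • x)
      = ∫⁻ x in K, K.indicator h ((1 - t) • y + t • x) := by
        refine setLIntegral_congr_fun hKm fun x hx => ?_
        have : (1 - t) • y + t • x ∈ K := hK hy hx (by linarith [ht.2]) ht0.le (by ring)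
        simp only [indicator_of_mem this]
    -- The indicator allows passage to the whole space, where translation and scaling produce the
    -- factor `t⁻ᵈ`; `t ≥ 1/2` bounds it by `2ᵈ`.
    _ ≤ ∫⁻ x, K.indicator h ((1 - t) • y + t • x) := setLIntegral_le_lintegral _ _
    _ = ∫⁻ x, K.indicator h ((1 - t) • y + x) ∂(Measure.map (t • ·) volume) := by
        rw [lintegral_map (by fun_prop) (by fun_prop)]
    _ = ENNReal.ofReal |(t ^ d)⁻¹| * ∫⁻ x, K.indicator h x := by
        rw [Measure.map_addHaar_smul _ ht0.ne', lintegral_smul_measure, finrank_euclideanSpace_fin,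
          lintegral_add_left_eq_self (fun x => K.indicator h x)]
        rfl
    _ ≤ 2 ^ d * ∫⁻ x in K, h x := by
        rw [lintegral_indicator hKm]
        gcongr
        rw [abs_of_pos (by positivity), ← inv_pow, ENNReal.ofReal_pow (by positivity)]
        gcongr
        rw [show (2 : ENNReal) = ENNReal.ofReal 2 by simp]
        refine ENNReal.ofReal_le_ofReal ?_
        rw [inv_le_comm₀ ht0 (by norm_num)]
        linarith [ht.1]

/-- Poincaré's inequality on a bounded convex set. -/
theorem exists_setLIntegral_sq_sub_le {K : Set (Euc d)} (hK : Convex ℝ K)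
    (hKm : MeasurableSet K) (hKb : Bornology.IsBounded K) {φ : Euc d → ℝ}
    (hφ : ContDiff ℝ 1 φ) :
    ∃ c : ℝ, ∫⁻ x in K, ENNReal.ofReal ((φ x - c) ^ 2)
      ≤ ENNReal.ofReal (Metric.diam K ^ 2) * 2 ^ d *
        ∫⁻ x in K, ENNReal.ofReal (‖fderiv ℝ φ x‖ ^ 2) := by
  rcases eq_or_ne (volume K) 0 with h0 | h0
  · exact ⟨0, by simp [Measure.restrict_eq_zero.2 h0]⟩
  have hfin : volume K ≠ ⊤ := hKb.measure_lt_top.ne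
  have hc : Continuous (fderiv ℝ φ) := hφ.continuous_fderiv (by simp)
  have hφc : Continuous φ := hφ.continuous
  set ψ : Euc d → ENNReal := fun x => ENNReal.ofReal (‖fderiv ℝ φ x‖ ^ 2) with hψ
  have hψc : Continuous ψ := ENNReal.continuous_ofReal.comp (by fun_prop)
  set D := ENNReal.ofReal (Metric.diam K ^ 2)
  set I := ∫⁻ x in K, ψ x with hI
  let G : Euc d → ENNReal := fun y => ∫⁻ x in K, ENNReal.ofReal ((φ x - φ y) ^ 2)
  have hG : Measurable G := by
    refine Measurable.lintegral_prod_right'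
      (f := fun z : Euc d × Euc d => ENNReal.ofReal ((φ z.2 - φ z.1) ^ 2)) ?_
    exact (ENNReal.continuous_ofReal.comp (by fun_prop)).measurable
  -- The subtracted constant is a value `φ y` at which `G` does not exceed its average over `K`. It
  -- remains to bound the double integral of `(φ x - φ y) ^ 2` over `K × K`.
  obtain ⟨y, -, hle⟩ := exists_le_setLAverage h0 hfin hG.aemeasurable
  refine ⟨φ y, hle.trans ?_⟩
  rw [setLAverage_eq]
  refine ENNReal.div_le_of_le_mul ?_
  have hpt : ∀ x ∈ K, ∀ y ∈ K, ENNReal.ofReal ((φ x - φ y) ^ 2)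
      ≤ D * ∫⁻ t in Icc (0 : ℝ) 1, ψ ((1 - t) • y + t • x) := by
    intro x hx y hy
    have hcs : Continuous fun t : ℝ => ‖fderiv ℝ φ ((1 - t) • y + t • x)‖ ^ 2 := by fun_prop
    rw [← ofReal_integral_eq_lintegral_ofReal (hcs.integrableOn_Icc)
      (Filter.Eventually.of_forall fun t => by positivity), integral_Icc_eq_integral_Ioc,
      ← intervalIntegral.integral_of_le (by norm_num), ← ENNReal.ofReal_mul (by positivity)]
    refine ENNReal.ofReal_le_ofReal ((sq_sub_le_integral_segment hφ y x).trans ?_)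
    gcongr
    · exact intervalIntegral.integral_nonneg (by norm_num) fun t _ => by positivity
    · exact Metric.dist_le_diam_of_mem hKb hy hx
  have hmeas : Measurable fun z : Euc d × Euc d × ℝ => ψ ((1 - z.2.2) • z.1 + z.2.2 • z.2.1) :=
    Continuous.measurable (by fun_prop)
  have hseg : ∀ t ∈ Icc (0 : ℝ) 1,
      ∫⁻ y in K, ∫⁻ x in K, ψ ((1 - t) • y + t • x) ≤ volume K * (2 ^ d * I) := by
    intro t ht
    -- The homothety with centre `y` and ratio `t` degenerates as `t` tends to `0`. For `t ≤ 1/2`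
    -- the integrals are swapped and the homothety with centre `x` and ratio `1 - t` is used.
    rcases le_total (1 / 2) t with h | h
    · calc ∫⁻ y in K, ∫⁻ x in K, ψ ((1 - t) • y + t • x)
          ≤ ∫⁻ y in K, 2 ^ d * I := setLIntegral_mono' hKm fun y hy =>
            setLIntegral_comp_homothety_le hK hKm hψc.measurable hy ⟨h, ht.2⟩
        _ = volume K * (2 ^ d * I) := by rw [setLIntegral_const, mul_comm]
    · rw [lintegral_lintegral_swap (Continuous.aemeasurable (by fun_prop))]
      calc ∫⁻ x in K, ∫⁻ y in K, ψ ((1 - t) • y + t • x)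
          ≤ ∫⁻ y in K, 2 ^ d * I := setLIntegral_mono' hKm fun x hx => by
            have := setLIntegral_comp_homothety_le hK hKm hψc.measurable hx (t := 1 - t)
              ⟨by linarith, by linarith [ht.1]⟩
            simpa [add_comm] using this
        _ = volume K * (2 ^ d * I) := by rw [setLIntegral_const, mul_comm]
  calc ∫⁻ y in K, G y
      ≤ ∫⁻ y in K, ∫⁻ x in K, D * ∫⁻ t in Icc (0 : ℝ) 1, ψ ((1 - t) • y + t • x) :=
        setLIntegral_mono' hKm fun y hy => setLIntegral_mono' hKm fun x hx => hpt x hx y hy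
    _ = ∫⁻ y in K, D * ∫⁻ t in Icc (0 : ℝ) 1, ∫⁻ x in K, ψ ((1 - t) • y + t • x) := by
        refine lintegral_congr fun y => ?_
        rw [lintegral_const_mul' _ _ ENNReal.ofReal_ne_top,
          lintegral_lintegral_swap (Continuous.aemeasurable (by fun_prop))]
    _ = D * ∫⁻ t in Icc (0 : ℝ) 1, ∫⁻ y in K, ∫⁻ x in K, ψ ((1 - t) • y + t • x) := by
        rw [lintegral_const_mul' _ _ ENNReal.ofReal_ne_top, lintegral_lintegral_swap]
        refine (Measurable.lintegral_prod_right'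
          (f := fun z : (Euc d × ℝ) × Euc d => ψ ((1 - z.1.2) • z.1.1 + z.1.2 • z.2))
          (Continuous.measurable (by fun_prop))).aemeasurable
    _ ≤ D * ∫⁻ t in Icc (0 : ℝ) 1, volume K * (2 ^ d * I) := by
        gcongr 1
        exact setLIntegral_mono' measurableSet_Icc hseg
    _ = D * 2 ^ d * I * volume K := by
        rw [setLIntegral_const]; simp; ring

end

section

/-! ### The Poincaré inequality on unions of convex sets -/

variable {d : ℕ}

theorem integrableOn_of_isBounded {f : Euc d → ℝ} (hf : Continuous f) {E : Set (Euc d)}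
    (hE : Bornology.IsBounded E) : IntegrableOn f E :=
  (hf.locallyIntegrable.integrableOn_isCompact hE.isCompact_closure).mono_set subset_closure

/-- Poincaré's inequality on `E` with constant `C`, for functions that are smooth on `ℝᵈ`. -/
def HasPoincare (E : Set (Euc d)) (C : ℝ) : Prop :=
  ∀ φ : Euc d → ℝ, ContDiff ℝ ∞ φ →
    ∃ c : ℝ, ∫ x in E, (φ x - c) ^ 2 ≤ C * ∫ x in E, ‖fderiv ℝ φ x‖ ^ 2

theorem HasPoincare.of_convex {K : Set (Euc d)} (hK : Convex ℝ K) (hKm : MeasurableSet K)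
    (hKb : Bornology.IsBounded K) : HasPoincare K (Metric.diam K ^ 2 * 2 ^ d) := by
  intro φ hφ
  obtain ⟨c, hc⟩ := exists_setLIntegral_sq_sub_le hK hKm hKb (hφ.of_le (by simp))
  have hcont : Continuous (fderiv ℝ φ) := hφ.continuous_fderiv (by simp)
  have hφc : Continuous φ := hφ.continuous
  have h2 : (2 : ENNReal) ^ d = ENNReal.ofReal (2 ^ d) := by
    rw [ENNReal.ofReal_pow (by norm_num)]; simp
  refine ⟨c, ?_⟩
  rw [← ofReal_integral_eq_lintegral_ofReal (integrableOn_of_isBounded (by fun_prop) hKb)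
      (Filter.Eventually.of_forall fun t => by positivity),
    ← ofReal_integral_eq_lintegral_ofReal (integrableOn_of_isBounded (by fun_prop) hKb)
      (Filter.Eventually.of_forall fun t => by positivity),
    h2, ← ENNReal.ofReal_mul (by positivity), ← ENNReal.ofReal_mul (by positivity)] at hc
  exact (ENNReal.ofReal_le_ofReal_iff
    (mul_nonneg (by positivity) (integral_nonneg fun x => by positivity))).1 hc

theorem HasPoincare.mono {E : Set (Euc d)} {C C' : ℝ} (h : HasPoincare E C) (hC : C ≤ C') :
    HasPoincare E C' := by
  intro φ hφ
  obtain ⟨c, hc⟩ := h φ hφ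
  exact ⟨c, hc.trans (mul_le_mul_of_nonneg_right hC (integral_nonneg fun x => by positivity))⟩

theorem HasPoincare.congr {E E' : Set (Euc d)} {C : ℝ} (h : HasPoincare E C)
    (hE : E =ᵐ[volume] E') : HasPoincare E' C := by
  intro φ hφ
  obtain ⟨c, hc⟩ := h φ hφ
  exact ⟨c, by rwa [← setIntegral_congr_set hE, ← setIntegral_congr_set hE]⟩

/-- A bounded measurable set on which Poincaré's inequality holds with some constant. -/
structure IsPoincareSet (E : Set (Euc d)) : Prop where
  measurableSet : MeasurableSet E
  isBounded : Bornology.IsBounded E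
  exists_hasPoincare : ∃ C : ℝ, 0 ≤ C ∧ HasPoincare E C

theorem IsPoincareSet.of_convex {K : Set (Euc d)} (hK : Convex ℝ K) (hKm : MeasurableSet K)
    (hKb : Bornology.IsBounded K) : IsPoincareSet K :=
  ⟨hKm, hKb, _, by positivity, HasPoincare.of_convex hK hKm hKb⟩

/-- The constant `a` that works on `E` also works on `F`: both estimates hold on the overlap, whose
measure `m` is positive, so `m * (a - b) ^ 2` is controlled by the gradient. The price is a factor
of order `1 / m`, harmless because only finitely many unions are formed. -/
theorem IsPoincareSet.union {E F : Set (Euc d)} (hE : IsPoincareSet E) (hF : IsPoincareSet F)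
    (hEF : volume (E ∩ F) ≠ 0) : IsPoincareSet (E ∪ F) := by
  obtain ⟨C₁, hC₁, h₁⟩ := hE.exists_hasPoincare
  obtain ⟨C₂, hC₂, h₂⟩ := hF.exists_hasPoincare
  have hb := hE.isBounded.union hF.isBounded
  have hm := hE.measurableSet.union hF.measurableSet
  have hpos : 0 < volume.real (E ∩ F) :=
    ENNReal.toReal_pos hEF (hE.isBounded.subset inter_subset_left).measure_lt_top.ne
  set m := volume.real (E ∩ F)
  set V := volume.real F
  have hV : 0 ≤ V := measureReal_nonneg
  refine ⟨hm, hb, C₁ + 2 * C₂ + 2 * (V * ((2 * C₁ + 2 * C₂) / m)), by positivity, ?_⟩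
  intro φ hφ
  have hcont : Continuous (fderiv ℝ φ) := hφ.continuous_fderiv (by simp)
  have hφc : Continuous φ := hφ.continuous
  obtain ⟨a, ha⟩ := h₁ φ hφ
  obtain ⟨b, hb'⟩ := h₂ φ hφ
  have hint : ∀ c : ℝ, IntegrableOn (fun x => (φ x - c) ^ 2) (E ∪ F) := fun c =>
    integrableOn_of_isBounded (by fun_prop) hb
  have hmono : ∀ {f : Euc d → ℝ} {S T : Set (Euc d)}, Continuous f → (∀ x, 0 ≤ f x) → S ⊆ T →
      T ⊆ E ∪ F → ∫ x in S, f x ≤ ∫ x in T, f x := fun hf hf0 hST hT =>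
    setIntegral_mono_set (integrableOn_of_isBounded hf (hb.subset hT))
      (Filter.Eventually.of_forall hf0) hST.eventuallyLE
  set I := ∫ x in E ∪ F, ‖fderiv ℝ φ x‖ ^ 2 with hI
  have hI0 : 0 ≤ I := integral_nonneg fun x => by positivity
  have hE' : ∫ x in E, (φ x - a) ^ 2 ≤ C₁ * I := ha.trans (by
    gcongr; exact hmono (by fun_prop) (fun x => by positivity) subset_union_left subset_rfl)
  have hF' : ∫ x in F, (φ x - b) ^ 2 ≤ C₂ * I := hb'.trans (by
    gcongr; exact hmono (by fun_prop) (fun x => by positivity) subset_union_right subset_rfl)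
  have hab : m * (a - b) ^ 2 ≤ (2 * C₁ + 2 * C₂) * I := by
    have hi := inter_subset_left.trans subset_union_left (a := E ∩ F) (b := E) (c := E ∪ F)
    calc m * (a - b) ^ 2 = ∫ x in E ∩ F, (a - b) ^ 2 := by simp [m]
      _ ≤ ∫ x in E ∩ F, (2 * (φ x - a) ^ 2 + 2 * (φ x - b) ^ 2) := by
          refine integral_mono (integrableOn_of_isBounded continuous_const (hb.subset hi))
            (integrableOn_of_isBounded (by fun_prop) (hb.subset hi)) fun x => ?_
          dsimp only
          nlinarith [sq_nonneg (φ x - a + (φ x - b))]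
      _ = 2 * (∫ x in E ∩ F, (φ x - a) ^ 2) + 2 * (∫ x in E ∩ F, (φ x - b) ^ 2) := by
          rw [integral_add, integral_const_mul, integral_const_mul]
          all_goals exact ((hint _).mono_set hi).const_mul 2
      _ ≤ 2 * (∫ x in E, (φ x - a) ^ 2) + 2 * (∫ x in F, (φ x - b) ^ 2) := by
          gcongr 2 * ?_ + 2 * ?_
          · exact hmono (by fun_prop) (fun x => by positivity) inter_subset_left subset_union_left
          · exact hmono (by fun_prop) (fun x => by positivity) inter_subset_right subset_union_right
      _ ≤ (2 * C₁ + 2 * C₂) * I := by linarith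
  refine ⟨a, ?_⟩
  calc (∫ x in E ∪ F, (φ x - a) ^ 2)
      = (∫ x in E, (φ x - a) ^ 2) + (∫ x in F \ E, (φ x - a) ^ 2) := by
        rw [← union_sdiff_self, setIntegral_union disjoint_sdiff_right
          (hF.measurableSet.diff hE.measurableSet) ((hint a).mono_set subset_union_left)
          ((hint a).mono_set (sdiff_subset.trans subset_union_right))]
    _ ≤ (∫ x in E, (φ x - a) ^ 2) + (∫ x in F, (φ x - a) ^ 2) := by
        refine add_le_add le_rfl ?_
        exact hmono (by fun_prop) (fun x => by positivity) sdiff_subset subset_union_right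
    _ ≤ (∫ x in E, (φ x - a) ^ 2) + ∫ x in F, (2 * (φ x - b) ^ 2 + 2 * (a - b) ^ 2) := by
        refine add_le_add le_rfl ?_
        refine integral_mono ((hint a).mono_set subset_union_right)
            (integrableOn_of_isBounded (by fun_prop) hF.isBounded) fun x => ?_
        dsimp only
        nlinarith [sq_nonneg (φ x - b + (a - b))]
    _ = (∫ x in E, (φ x - a) ^ 2) + (2 * (∫ x in F, (φ x - b) ^ 2) + V * (2 * (a - b) ^ 2)) := by
        rw [integral_add (((hint b).mono_set subset_union_right).const_mul 2)
          (integrableOn_of_isBounded continuous_const hF.isBounded), integral_const_mul]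
        simp [V]
    _ ≤ C₁ * I + (2 * (C₂ * I) + V * (2 * ((2 * C₁ + 2 * C₂) * I / m))) := by
        gcongr
        rw [le_div_iff₀ hpos, mul_comm]
        exact hab
    _ = _ := by ring

theorem measure_inter_ne_zero {E F : Set (Euc d)} {x : Euc d} (hE : E ∈ 𝓝 x) (hF : F ∈ 𝓝 x) :
    volume (E ∩ F) ≠ 0 :=
  (Measure.measure_pos_of_mem_nhds volume (Filter.inter_mem hE hF)).ne'

/-- Any two points of a connected open set lie in the interior of a Poincaré set. -/
theorem exists_isPoincareSet_nhds {U : Set (Euc d)} (hU : IsOpen U) (hc : IsPreconnected U)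
    {x y : Euc d} (hx : x ∈ U) (hy : y ∈ U) :
    ∃ E ⊆ U, IsPoincareSet E ∧ E ∈ 𝓝 x ∧ E ∈ 𝓝 y := by
  refine hc.induction₂ (fun x y => ∃ E ⊆ U, IsPoincareSet E ∧ E ∈ 𝓝 x ∧ E ∈ 𝓝 y) ?_ ?_ ?_ hx hy
  · intro x hx
    obtain ⟨r, hr, hrU⟩ := Metric.isOpen_iff.1 hU x hx
    filter_upwards [mem_nhdsWithin_of_mem_nhds (Metric.ball_mem_nhds x hr)] with y hy
    exact ⟨_, hrU, IsPoincareSet.of_convex (convex_ball x r) measurableSet_ball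
      Metric.isBounded_ball, Metric.ball_mem_nhds x hr, Metric.isOpen_ball.mem_nhds hy⟩
  -- Both sets are neighbourhoods of the middle point `y`, so their overlap has positive measure.
  · rintro x y z - - - ⟨E, hEU, hE, hEx, hEy⟩ ⟨F, hFU, hF, hFy, hFz⟩
    exact ⟨E ∪ F, union_subset hEU hFU, hE.union hF (measure_inter_ne_zero hEy hFy),
      Filter.mem_of_superset hEx subset_union_left, Filter.mem_of_superset hFz subset_union_right⟩
  · rintro x y - - ⟨E, hEU, hE, hEx, hEy⟩
    exact ⟨E, hEU, hE, hEy, hEx⟩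

/-- Poincaré's inequality on a connected open set that is covered up to a null set by finitely
many bounded convex open subsets. -/
theorem IsPoincareSet.of_convex_cover {ι : Type*} {U : Set (Euc d)} (hU : IsOpen U)
    (hc : IsConnected U) (s : Finset ι) (T : ι → Set (Euc d)) (hT : ∀ i ∈ s, Convex ℝ (T i))
    (hTo : ∀ i ∈ s, IsOpen (T i)) (hTb : ∀ i ∈ s, Bornology.IsBounded (T i))
    (hTU : ∀ i ∈ s, T i ⊆ U) (hcov : volume (U \ ⋃ i ∈ s, T i) = 0) :
    ∃ C : ℝ, 0 ≤ C ∧ HasPoincare U C := by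
  classical
  obtain ⟨x₀, hx₀⟩ := hc.nonempty
  -- The `T i` may be pairwise disjoint, so each is attached through a bridge `F` from `x₀` to one
  -- of its points. Keeping the growing set a neighbourhood of `x₀` ensures that it overlaps the
  -- bridge.
  have key : ∀ s' ⊆ s, ∃ E ⊆ U, IsPoincareSet E ∧ E ∈ 𝓝 x₀ ∧ ∀ i ∈ s', T i ⊆ E := by
    intro s'
    induction s' using Finset.induction_on with
    | empty =>
      intro _
      obtain ⟨E, hEU, hE, hEx, -⟩ := exists_isPoincareSet_nhds hU hc.isPreconnected hx₀ hx₀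
      exact ⟨E, hEU, hE, hEx, by simp⟩
    | insert i s' _ ih =>
      intro hs
      obtain ⟨E, hEU, hE, hEx, hTE⟩ := ih ((Finset.subset_insert _ _).trans hs)
      have hi : i ∈ s := hs (Finset.mem_insert_self _ _)
      rcases (T i).eq_empty_or_nonempty with h0 | ⟨y, hy⟩
      · refine ⟨E, hEU, hE, hEx, fun j hj => ?_⟩
        rcases Finset.mem_insert.1 hj with rfl | hj
        · simp [h0]
        · exact hTE j hj
      · obtain ⟨F, hFU, hF, hFx, hFy⟩ :=
          exists_isPoincareSet_nhds hU hc.isPreconnected hx₀ (hTU i hi hy)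
        have hyE : E ∪ F ∈ 𝓝 y := Filter.mem_of_superset hFy subset_union_right
        refine ⟨E ∪ F ∪ T i, union_subset (union_subset hEU hFU) (hTU i hi),
          (hE.union hF (measure_inter_ne_zero hEx hFx)).union
            (IsPoincareSet.of_convex (hT i hi) (hTo i hi).measurableSet (hTb i hi))
            (measure_inter_ne_zero hyE ((hTo i hi).mem_nhds hy)),
          Filter.mem_of_superset hEx (subset_union_left.trans subset_union_left), fun j hj => ?_⟩
        rcases Finset.mem_insert.1 hj with rfl | hj
        · exact subset_union_right
        · exact (hTE j hj).trans (subset_union_left.trans subset_union_left)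
  obtain ⟨E, hEU, hE, -, hTE⟩ := key s subset_rfl
  obtain ⟨C, hC, h⟩ := hE.exists_hasPoincare
  refine ⟨C, hC, h.congr (Filter.EventuallyLE.antisymm hEU.eventuallyLE (ae_le_set.2 ?_))⟩
  exact measure_mono_null (sdiff_subset_sdiff_right (iUnion₂_subset hTE)) hcov

end

section

/-! ### Measure-theoretic properties of simplicial meshes -/

variable {d : ℕ} {Ω : TopologicalSpace.Opens (Euc d)}

/-- A Lipschitz domain lies on one side of its boundary. -/
theorem IsBoundedLipschitzDomain.interior_closure_subset (hΩ : IsBoundedLipschitzDomain Ω) :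
    interior (closure (Ω : Set (Euc d))) ⊆ Ω := by
  intro x₀ hx₀
  by_contra hx
  have hfr : x₀ ∈ frontier (Ω : Set (Euc d)) :=
    ⟨interior_subset hx₀, by rwa [Ω.isOpen.interior_eq]⟩
  obtain ⟨e, he, K, g, hg, U, hU, hUe⟩ := hΩ.lipschitz_boundary x₀ hfr
  have hee : inner ℝ e e = (1 : ℝ) := by rw [real_inner_self_eq_norm_sq, he]; norm_num
  have hcont : Continuous fun t : ℝ => x₀ - t • e := by fun_prop
  have hV : interior U ∩ interior (closure (Ω : Set (Euc d))) ∈ 𝓝 (x₀ - (0 : ℝ) • e) := by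
    rw [zero_smul, sub_zero]
    exact Filter.inter_mem (interior_mem_nhds.2 hU) (isOpen_interior.mem_nhds hx₀)
  have hev : ∀ᶠ t : ℝ in 𝓝[>] 0,
      x₀ - t • e ∈ interior U ∩ interior (closure (Ω : Set (Euc d))) :=
    (hcont.continuousAt.eventually_mem hV).filter_mono nhdsWithin_le_nhds
  obtain ⟨t, ht, ht0⟩ := (hev.and self_mem_nhdsWithin).exists
  have ht0 : 0 < t := ht0
  -- The point `x₀` lies on or below the graph, so `x₀ - t • e` lies strictly below it. Near that
  -- point everything is strictly below the graph and misses `Ω`, although the point is in the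
  -- closure of `Ω`.
  have hlow : inner ℝ e x₀ ≤ g (x₀ - (inner ℝ e x₀) • e) :=
    not_lt.1 fun h => hx ((hUe x₀ (mem_of_mem_nhds hU)).2 h)
  have hgc : Continuous g := hg.continuous
  have hO : IsOpen {x : Euc d | inner ℝ e x < g (x - (inner ℝ e x) • e)} :=
    isOpen_lt (by fun_prop) (by fun_prop)
  have hmem : x₀ - t • e ∈ {x : Euc d | inner ℝ e x < g (x - (inner ℝ e x) • e)} := by
    have h1 : inner ℝ e (x₀ - t • e) = inner ℝ e x₀ - t := by
      rw [inner_sub_right, inner_smul_right, hee, mul_one]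
    have h2 : x₀ - t • e - (inner ℝ e x₀ - t) • e = x₀ - (inner ℝ e x₀) • e := by
      rw [sub_smul]; abel
    rw [mem_ofPred_eq, h1, h2]
    linarith
  obtain ⟨z, ⟨hz1, hz2⟩, hzΩ⟩ := mem_closure_iff.1 (interior_subset ht.2) _
    (isOpen_interior.inter hO) ⟨ht.1, hmem⟩
  exact lt_asymm hz2 ((hUe z (interior_subset hz1)).1 hzΩ)

theorem convex_simplex (s : Finset (Euc d)) : Convex ℝ (simplex s) := convex_convexHull ℝ _

theorem isCompact_simplex (s : Finset (Euc d)) : IsCompact (simplex s) :=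
  s.finite_toSet.isCompact_convexHull ℝ

theorem measurableSet_simplex (s : Finset (Euc d)) : MeasurableSet (simplex s) :=
  (isCompact_simplex s).measurableSet

theorem measure_simplex_diff_interior (s : Finset (Euc d)) :
    volume (simplex s \ interior (simplex s)) = 0 := by
  have h := (convex_simplex s).addHaar_frontier volume
  rwa [(isCompact_simplex s).isClosed.frontier_eq] at h

namespace SimplicialMesh

variable (M : SimplicialMesh Ω)

theorem simplex_subset_closure {s : Finset (Euc d)} (hs : s ∈ M.cells) :
    simplex s ⊆ closure (Ω : Set (Euc d)) := by
  rw [← M.covers]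
  exact subset_biUnion_of_mem (u := fun s : Finset (Euc d) => convexHull ℝ (s : Set (Euc d))) hs

theorem subset_iUnion_simplex : (Ω : Set (Euc d)) ⊆ ⋃ s ∈ M.cells, simplex s :=
  subset_closure.trans M.covers.symm.subset

theorem interior_simplex_subset (hΩ : IsBoundedLipschitzDomain Ω) {s : Finset (Euc d)}
    (hs : s ∈ M.cells) : interior (simplex s) ⊆ Ω :=
  (interior_mono (M.simplex_subset_closure hs)).trans hΩ.interior_closure_subset

theorem simplex_inter_ae_eq (hΩ : IsBoundedLipschitzDomain Ω) {s : Finset (Euc d)}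
    (hs : s ∈ M.cells) : (simplex s ∩ Ω : Set (Euc d)) =ᵐ[volume] simplex s := by
  refine Filter.EventuallyLE.antisymm inter_subset_left.eventuallyLE (ae_le_set.2 ?_)
  rw [sdiff_self_inter]
  exact measure_mono_null (sdiff_subset_sdiff_right (M.interior_simplex_subset hΩ hs))
    (measure_simplex_diff_interior s)

/-- Distinct cells have equally many vertices, so `s` has a vertex `v` outside `t`. By conformity
the intersection lies in the affine span of the common vertices. Affine independence keeps `v` out
of this span, which is therefore a proper, hence null, affine subspace. -/
theorem aedisjoint_simplex {s t : Finset (Euc d)} (hs : s ∈ M.cells) (ht : t ∈ M.cells)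
    (hst : s ≠ t) : AEDisjoint volume (simplex s) (simplex t) := by
  classical
  obtain ⟨v, hvs, hvt⟩ : ∃ v ∈ s, v ∉ t := by
    by_contra! h
    exact hst (Finset.eq_of_subset_of_card_le h (by rw [M.card_eq s hs, M.card_eq t ht]))
  rw [AEDisjoint, simplex, simplex, M.conforming s hs t ht]
  refine measure_mono_null (convexHull_subset_affineSpan _)
    (Measure.addHaar_affineSubspace volume _ fun htop => ?_)
  have hv : v ∈ affineSpan ℝ ((s : Set (Euc d)) ∩ t) := htop ▸ AffineSubspace.mem_top ℝ _ v
  have hind := (M.affineIndependent s hs).notMem_affineSpan_sdiff ⟨v, hvs⟩ univ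
  refine hind (affineSpan_mono ℝ ?_ hv)
  rintro w ⟨hws, hwt⟩
  refine ⟨⟨w, hws⟩, ⟨mem_univ _, fun h => hvt ?_⟩, rfl⟩
  have : w = v := congrArg Subtype.val h
  exact this ▸ hwt

theorem setIntegral_iUnion_simplex {F : Finset (Finset (Euc d))} (hF : F ⊆ M.cells)
    {f : Euc d → ℝ} (hf : IntegrableOn f (Ω : Set (Euc d))) :
    ∫ x in (⋃ s ∈ F, simplex s) ∩ Ω, f x = ∑ s ∈ F, ∫ x in simplex s ∩ Ω, f x := by
  have hU : (⋃ s ∈ F, simplex s) ∩ (Ω : Set (Euc d)) = ⋃ s : F, simplex s.1 ∩ Ω := by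
    rw [iUnion₂_inter, iUnion_subtype]
  rw [hU, integral_iUnion_ae, tsum_fintype, ← Finset.sum_coe_sort F]
  · exact fun s => ((measurableSet_simplex _).inter Ω.isOpen.measurableSet).nullMeasurableSet
  · intro s t hst
    exact (M.aedisjoint_simplex (hF s.2) (hF t.2) (Subtype.coe_injective.ne hst)).mono
      inter_subset_left inter_subset_left
  · exact hf.mono_set (iUnion_subset fun s => inter_subset_right)

theorem setIntegral_eq_sum {f : Euc d → ℝ} (hf : IntegrableOn f (Ω : Set (Euc d))) :
    ∫ x in (Ω : Set (Euc d)), f x = ∑ s ∈ M.cells, ∫ x in simplex s ∩ Ω, f x := by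
  rw [← M.setIntegral_iUnion_simplex subset_rfl hf, inter_eq_right.2 M.subset_iUnion_simplex]

theorem diam_le_H {s : Finset (Euc d)} (hs : s ∈ M.cells) : Metric.diam (simplex s) ≤ M.H :=
  le_ciSup (f := fun s : M.cells => Metric.diam (simplex s.1)) (Set.finite_range _).bddAbove ⟨s, hs⟩

theorem H_nonneg : 0 ≤ M.H := Real.iSup_nonneg fun _ => Metric.diam_nonneg

theorem H_le_diam (hΩ : Bornology.IsBounded (Ω : Set (Euc d))) :
    M.H ≤ Metric.diam (Ω : Set (Euc d)) :=
  Real.iSup_le (fun s => by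
    rw [← Metric.diam_closure (s := (Ω : Set (Euc d)))]
    exact Metric.diam_mono (M.simplex_subset_closure s.2) hΩ.closure) Metric.diam_nonneg

theorem hasPoincare_simplex (hΩ : IsBoundedLipschitzDomain Ω) {s : Finset (Euc d)}
    (hs : s ∈ M.cells) : HasPoincare (simplex s ∩ Ω : Set (Euc d)) (M.H ^ 2 * 2 ^ d) :=
  ((HasPoincare.of_convex (convex_simplex s) (measurableSet_simplex s)
    (isCompact_simplex s).isBounded).mono (mul_le_mul_of_nonneg_right
      (pow_le_pow_left₀ Metric.diam_nonneg (M.diam_le_H hs) 2) (by positivity))).congr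
    (M.simplex_inter_ae_eq hΩ hs).symm

/-- Poincaré's inequality on a Lipschitz domain that has a simplicial mesh. -/
theorem exists_hasPoincare (M : SimplicialMesh Ω) (hΩ : IsBoundedLipschitzDomain Ω) :
    ∃ C : ℝ, 0 ≤ C ∧ HasPoincare (Ω : Set (Euc d)) C := by
  refine IsPoincareSet.of_convex_cover Ω.isOpen hΩ.isConnected M.cells
    (fun s => interior (simplex s)) (fun s _ => (convex_simplex s).interior)
    (fun s _ => isOpen_interior) (fun s _ => (isCompact_simplex s).isBounded.subset interior_subset)
    (fun s hs => M.interior_simplex_subset hΩ hs) ?_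
  refine measure_mono_null (t := ⋃ s ∈ M.cells, simplex s \ interior (simplex s)) ?_
    ((measure_biUnion_null_iff M.cells.countable_toSet).2 fun s _ =>
      measure_simplex_diff_interior s)
  rintro x ⟨hxΩ, hx⟩
  obtain ⟨s, hs, hxs⟩ := mem_iUnion₂.1 (M.subset_iUnion_simplex hxΩ)
  exact mem_iUnion₂.2 ⟨s, hs, hxs, fun h => hx (mem_iUnion₂.2 ⟨s, hs, h⟩)⟩

/-! ### Neighbouring elements and their bounded number. -/

open Classical in
/-- The elements that meet the element `s`. -/
noncomputable def neighbours (s : Finset (Euc d)) : Finset (Finset (Euc d)) :=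
  M.cells.filter fun t => (simplex t ∩ simplex s).Nonempty

theorem mem_neighbours {s t : Finset (Euc d)} :
    t ∈ M.neighbours s ↔ t ∈ M.cells ∧ (simplex t ∩ simplex s).Nonempty := by
  simp [neighbours]

theorem neighbours_subset (s : Finset (Euc d)) : M.neighbours s ⊆ M.cells :=
  fun _ ht => (M.mem_neighbours.1 ht).1

theorem patch_eq (s : Finset (Euc d)) : M.patch s = ⋃ t ∈ M.neighbours s, simplex t := by
  ext x
  simp only [patch, mem_iUnion, mem_neighbours, exists_prop, and_assoc]

theorem mem_neighbours_comm {s t : Finset (Euc d)} (hs : s ∈ M.cells) (ht : t ∈ M.cells) :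
    t ∈ M.neighbours s ↔ s ∈ M.neighbours t := by
  simp [mem_neighbours, hs, ht, inter_comm]

/-- In a shape-regular quasi-uniform mesh, the number of neighbours of an element is bounded. -/
theorem card_neighbours_le (hd : 0 < d) {γqu γsr : ℝ} (hγ : 0 < γqu) (hqu : M.IsQuasiUniform γqu)
    (hsr : M.IsShapeRegular γsr) {s : Finset (Euc d)} (hs : s ∈ M.cells) :
    ((M.neighbours s).card : ℝ) ≤ (4 * γsr / γqu) ^ d := by
  have hdiam : ∀ {x : Euc d} {r : ℝ} {t : Finset (Euc d)}, 0 < r →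
      Metric.closedBall x r ⊆ simplex t → r ≤ Metric.diam (simplex t) := by
    intro x r t hr h
    let e : Euc d := EuclideanSpace.single ⟨0, hd⟩ 1
    have he : dist (x + r • e) x = r := by
      rw [dist_eq_norm, add_sub_cancel_left, norm_smul]
      simp [e, abs_of_pos hr]
    rw [← he]
    refine Metric.dist_le_diam_of_mem (isCompact_simplex t).isBounded (h ?_)
      (h (Metric.mem_closedBall_self hr.le))
    rw [Metric.mem_closedBall, he]
  obtain ⟨x, r, hr, hxr, hdr⟩ := hsr s hs
  have hsd : 0 < Metric.diam (simplex s) := hr.trans_le (hdiam hr hxr)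
  have hH : 0 < M.H := hsd.trans_le (M.diam_le_H hs)
  have hγsr : 0 < γsr := by
    by_contra! h
    nlinarith
  have hxs : x ∈ simplex s := hxr (Metric.mem_closedBall_self hr.le)
  -- By quasi-uniformity and shape regularity every element contains a ball of radius at least `ρ`.
  -- All neighbours of `s` lie in a ball of radius `2 * M.H` and are disjoint up to null sets, so
  -- comparing volumes bounds their number by `(2 * M.H / ρ) ^ d`.
  set ρ := γqu * M.H / (2 * γsr) with hρ
  have hρ0 : 0 < ρ := by positivity
  have hsub : ⋃ t ∈ M.neighbours s, simplex t ⊆ Metric.closedBall x (2 * M.H) := by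
    refine iUnion₂_subset fun t ht y hy => ?_
    obtain ⟨htc, z, hzt, hzs⟩ := M.mem_neighbours.1 ht
    have h1 := Metric.dist_le_diam_of_mem (isCompact_simplex t).isBounded hy hzt
    have h2 := Metric.dist_le_diam_of_mem (isCompact_simplex s).isBounded hzs hxs
    rw [Metric.mem_closedBall]
    linarith [dist_triangle y z x, M.diam_le_H htc, M.diam_le_H hs]
  have hvol : ∀ t ∈ M.neighbours s, volume (Metric.closedBall (0 : Euc d) ρ) ≤ volume (simplex t) := by
    intro t ht
    have htc := (M.mem_neighbours.1 ht).1
    obtain ⟨y, r', hr', hyr, hdr'⟩ := hsr t htc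
    have hle : ρ ≤ r' := by
      rw [hρ, div_le_iff₀ (by positivity)]
      linarith [hqu t htc]
    rw [Measure.addHaar_closedBall_center volume 0 ρ, ← Measure.addHaar_closedBall_center volume y ρ]
    exact measure_mono ((Metric.closedBall_subset_closedBall hle).trans hyr)
  have hsum : (M.neighbours s).card * volume (Metric.closedBall (0 : Euc d) ρ)
      ≤ volume (Metric.closedBall x (2 * M.H)) := by
    rw [← nsmul_eq_mul, ← Finset.sum_const]
    refine (Finset.sum_le_sum hvol).trans ((measure_biUnion_finset₀ ?_ fun t _ =>
      (measurableSet_simplex t).nullMeasurableSet).symm.le.trans (measure_mono hsub))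
    intro t ht t' ht' hne
    exact M.aedisjoint_simplex (M.mem_neighbours.1 ht).1 (M.mem_neighbours.1 ht').1 hne
  rw [Measure.addHaar_closedBall _ _ hρ0.le, Measure.addHaar_closedBall _ _ (by positivity),
    finrank_euclideanSpace_fin, ← mul_assoc,
    ENNReal.mul_le_mul_iff_left (Metric.measure_ball_pos _ _ one_pos).ne' measure_ball_lt_top.ne,
    ← ENNReal.ofReal_natCast, ← ENNReal.ofReal_mul (by positivity),
    ENNReal.ofReal_le_ofReal_iff (by positivity), ← le_div_iff₀ (by positivity), ← div_pow] at hsum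
  refine hsum.trans_eq ?_
  rw [hρ]
  congr 1
  field_simp
  ring

end SimplicialMesh

/-! ### Local norms -/

variable {F : Type*} [NormedAddCommGroup F]

theorem integrableOn_norm_sq (v : Lp F 2 (volume.restrict (Ω : Set (Euc d)))) :
    IntegrableOn (fun x => ‖v x‖ ^ 2) (Ω : Set (Euc d)) :=
  (memLp_two_iff_integrable_sq_norm (Lp.memLp v).1).1 (Lp.memLp v)

theorem norm_sq_eq_setIntegral [InnerProductSpace ℝ F]
    (v : Lp F 2 (volume.restrict (Ω : Set (Euc d)))) :
    ‖v‖ ^ 2 = ∫ x in (Ω : Set (Euc d)), ‖v x‖ ^ 2 := by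
  rw [← real_inner_self_eq_norm_sq, L2.inner_def]
  simp_rw [real_inner_self_eq_norm_sq]

theorem normSqOn_nonneg (v : Lp F 2 (volume.restrict (Ω : Set (Euc d)))) (T : Set (Euc d)) :
    0 ≤ normSqOn v T := integral_nonneg fun x => by positivity

namespace SimplicialMesh

variable (M : SimplicialMesh Ω)

theorem sum_normSqOn [InnerProductSpace ℝ F]
    (v : Lp F 2 (volume.restrict (Ω : Set (Euc d)))) :
    ∑ s ∈ M.cells, normSqOn v (simplex s) = ‖v‖ ^ 2 := by
  rw [norm_sq_eq_setIntegral, M.setIntegral_eq_sum (integrableOn_norm_sq v)]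
  rfl

/-- Double counting: being neighbours is symmetric, so an element `t` is counted once for each of
its own neighbours. -/
theorem sum_normSqOn_patch_le [InnerProductSpace ℝ F] (hd : 0 < d) {γqu γsr : ℝ} (hγ : 0 < γqu)
    (hqu : M.IsQuasiUniform γqu) (hsr : M.IsShapeRegular γsr)
    (v : Lp F 2 (volume.restrict (Ω : Set (Euc d)))) :
    ∑ s ∈ M.cells, normSqOn v (M.patch s) ≤ (4 * γsr / γqu) ^ d * ‖v‖ ^ 2 := by
  classical
  have hpatch : ∀ s, normSqOn v (M.patch s)
      = ∑ t ∈ M.cells, if t ∈ M.neighbours s then normSqOn v (simplex t) else 0 := by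
    intro s
    rw [← Finset.sum_filter, normSqOn, patch_eq,
      M.setIntegral_iUnion_simplex (M.neighbours_subset s) (integrableOn_norm_sq v)]
    refine Finset.sum_congr ?_ fun _ _ => rfl
    ext t
    simp +contextual [mem_neighbours]
  simp_rw [hpatch]
  rw [Finset.sum_comm, ← M.sum_normSqOn v, Finset.mul_sum]
  refine Finset.sum_le_sum fun t ht => ?_
  rw [Finset.sum_congr rfl fun s hs => if_congr (M.mem_neighbours_comm hs ht) rfl rfl,
    ← Finset.sum_filter, Finset.sum_const, nsmul_eq_mul]
  refine mul_le_mul_of_nonneg_right (le_trans ?_ (M.card_neighbours_le hd hγ hqu hsr ht))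
    (normSqOn_nonneg _ _)
  exact_mod_cast Finset.card_le_card fun s hs => (Finset.mem_filter.1 hs).2

end SimplicialMesh

end

section

/-! ### Right inverses of the divergence -/

theorem sq_integral_mul_le {X : Type*} [MeasurableSpace X] {μ : Measure X} {f g : X → ℝ}
    (hf : MemLp f 2 μ) (hg : MemLp g 2 μ) :
    (∫ x, f x * g x ∂μ) ^ 2 ≤ (∫ x, f x ^ 2 ∂μ) * ∫ x, g x ^ 2 ∂μ := by
  have key : ∀ {f g : X → ℝ} (hf : MemLp f 2 μ) (hg : MemLp g 2 μ),
      inner ℝ (hf.toLp f) (hg.toLp g) = ∫ x, f x * g x ∂μ := by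
    intro f g hf hg
    rw [L2.inner_def]
    refine integral_congr_ae ?_
    filter_upwards [hf.coeFn_toLp, hg.coeFn_toLp] with x h1 h2
    rw [h1, h2, real_inner_comm]
    rfl
  have h := real_inner_mul_inner_self_le (hf.toLp f) (hg.toLp g)
  simp_rw [key, ← pow_two] at h
  exact h

/-- A linear functional that is bounded by `K ‖T x‖` has a representer of norm at most `K`. -/
theorem exists_representer {X E : Type*} [AddCommGroup X] [Module ℝ X] [NormedAddCommGroup E]
    [InnerProductSpace ℝ E] [CompleteSpace E] (T : X →ₗ[ℝ] E) (l : X →ₗ[ℝ] ℝ) {K : ℝ}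
    (hK : 0 ≤ K) (h : ∀ x, |l x| ≤ K * ‖T x‖) :
    ∃ w : E, ‖w‖ ≤ K ∧ ∀ x, inner ℝ (T x) w = l x := by
  -- The bound forces `l` to vanish on the kernel of `T`, so `l` descends to the range of `T`.
  have hker : LinearMap.ker T.rangeRestrict ≤ LinearMap.ker l := by
    intro x hx
    rw [LinearMap.ker_rangeRestrict, LinearMap.mem_ker] at hx
    have := h x
    rw [hx, norm_zero, mul_zero] at this
    exact abs_eq_zero.1 (this.antisymm (abs_nonneg _))
  obtain ⟨l', hl'⟩ : ∃ l' : LinearMap.range T →ₗ[ℝ] ℝ, l' ∘ₗ T.rangeRestrict = l := by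
    obtain ⟨S, hS⟩ := T.rangeRestrict.exists_rightInverse_of_surjective T.range_rangeRestrict
    refine ⟨l ∘ₗ S, LinearMap.ext fun x => ?_⟩
    have : S (T.rangeRestrict x) - x ∈ LinearMap.ker T.rangeRestrict := by
      rw [LinearMap.mem_ker, map_sub, sub_eq_zero]
      exact LinearMap.congr_fun hS _
    have := hker this
    rw [LinearMap.mem_ker, map_sub, sub_eq_zero] at this
    exact this
  have hbd : ∀ y : LinearMap.range T, ‖l' y‖ ≤ K * ‖y‖ := by
    rintro ⟨_, x, rfl⟩
    have : l' ⟨T x, x, rfl⟩ = l x := LinearMap.congr_fun hl' x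
    rw [this]
    exact h x
  -- The range of `T` need not be closed; Hahn-Banach extends the functional to all of `E` without
  -- increasing the norm, and Riesz represents it.
  obtain ⟨L, hL, hLn⟩ := exists_extension_norm_eq _ (l'.mkContinuous K hbd)
  refine ⟨(InnerProductSpace.toDual ℝ E).symm L, ?_, fun x => ?_⟩
  · rw [LinearIsometryEquiv.norm_map, hLn]
    exact l'.mkContinuous_norm_le hK hbd
  · rw [real_inner_comm, InnerProductSpace.toDual_symm_apply]
    exact (hL ⟨T x, x, rfl⟩).trans (LinearMap.congr_fun hl' x)

variable {d : ℕ}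

/-- The smooth functions with compact support in `ℝᵈ`. -/
def testFunctions (d : ℕ) : Submodule ℝ (Euc d → ℝ) where
  carrier := {φ | ContDiff ℝ ∞ φ ∧ HasCompactSupport φ}
  add_mem' hφ hψ := ⟨hφ.1.add hψ.1, hφ.2.add hψ.2⟩
  zero_mem' := ⟨contDiff_const, HasCompactSupport.zero⟩
  smul_mem' c _ hφ := ⟨contDiff_const.smul hφ.1, hφ.2.mono fun x hx h => hx (by simp [h])⟩

theorem testFunctions.memLp (Ω : TopologicalSpace.Opens (Euc d)) (φ : testFunctions d) :
    MemLp φ.1 2 (volume.restrict (Ω : Set (Euc d))) :=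
  (φ.2.1.continuous.memLp_of_hasCompactSupport φ.2.2).restrict _

theorem testFunctions.memLp_gradient (Ω : TopologicalSpace.Opens (Euc d)) (φ : testFunctions d) :
    MemLp (gradient φ.1) 2 (volume.restrict (Ω : Set (Euc d))) := by
  have hc : Continuous (fderiv ℝ φ.1) := φ.2.1.continuous_fderiv (by simp)
  have h : MemLp (fderiv ℝ φ.1) 2 (volume.restrict (Ω : Set (Euc d))) :=
    (hc.memLp_of_hasCompactSupport (φ.2.2.fderiv (𝕜 := ℝ))).restrict _
  refine h.of_le ?_ (Filter.Eventually.of_forall fun x => ?_)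
  · exact ((InnerProductSpace.toDual ℝ (Euc d)).symm.continuous.comp hc).aestronglyMeasurable
  · exact ((InnerProductSpace.toDual ℝ (Euc d)).symm.norm_map _).le

/-- The restriction of test functions to `Ω`. -/
noncomputable def testLp (Ω : TopologicalSpace.Opens (Euc d)) : testFunctions d →ₗ[ℝ] L2 Ω where
  toFun φ := (testFunctions.memLp Ω φ).toLp φ.1
  map_add' φ ψ := MemLp.toLp_add (testFunctions.memLp Ω φ) (testFunctions.memLp Ω ψ)
  map_smul' c φ := MemLp.toLp_const_smul c (testFunctions.memLp Ω φ)

/-- The restriction of the gradients of test functions to `Ω`. -/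
noncomputable def gradLp (Ω : TopologicalSpace.Opens (Euc d)) :
    testFunctions d →ₗ[ℝ] L2Vec Ω where
  toFun φ := (testFunctions.memLp_gradient Ω φ).toLp (gradient φ.1)
  map_add' φ ψ := by
    rw [← MemLp.toLp_add]
    refine MemLp.toLp_congr _ _ (Filter.Eventually.of_forall fun x => ?_)
    simp only [gradient, Submodule.coe_add, Pi.add_apply]
    rw [fderiv_add (φ.2.1.differentiable (by simp) x) (ψ.2.1.differentiable (by simp) x), map_add]
  map_smul' c φ := by
    rw [RingHom.id_apply, ← MemLp.toLp_const_smul]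
    refine MemLp.toLp_congr _ _ (Filter.Eventually.of_forall fun x => ?_)
    simp only [gradient, Submodule.coe_smul, Pi.smul_apply]
    rw [fderiv_const_smul (φ.2.1.differentiable (by simp) x)]
    simp

variable {Ω : TopologicalSpace.Opens (Euc d)}

theorem inner_testLp (g : L2 Ω) (φ : testFunctions d) :
    inner ℝ g (testLp Ω φ) = ∫ x in (Ω : Set (Euc d)), g x * φ.1 x := by
  rw [L2.inner_def]
  refine integral_congr_ae ?_
  filter_upwards [(testFunctions.memLp Ω φ).coeFn_toLp] with x h
  change inner ℝ (g x) ((testFunctions.memLp Ω φ).toLp φ.1 x) = _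
  rw [h, real_inner_comm]
  rfl

theorem inner_gradLp (v : L2Vec Ω) (φ : testFunctions d) :
    inner ℝ (gradLp Ω φ) v = ∫ x in (Ω : Set (Euc d)), fderiv ℝ φ.1 x (v x) := by
  rw [L2.inner_def]
  refine integral_congr_ae ?_
  filter_upwards [(testFunctions.memLp_gradient Ω φ).coeFn_toLp] with x h
  rw [gradLp, LinearMap.coe_mk, AddHom.coe_mk, h, gradient, InnerProductSpace.toDual_symm_apply]

theorem norm_sq_gradLp (φ : testFunctions d) :
    ‖gradLp Ω φ‖ ^ 2 = ∫ x in (Ω : Set (Euc d)), ‖fderiv ℝ φ.1 x‖ ^ 2 := by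
  rw [norm_sq_eq_setIntegral]
  refine integral_congr_ae ?_
  filter_upwards [(testFunctions.memLp_gradient Ω φ).coeFn_toLp] with x h
  rw [gradLp, LinearMap.coe_mk, AddHom.coe_mk, h, gradient, LinearIsometryEquiv.norm_map]

theorem toL2_injective : Function.Injective (toL2 Ω) := fun _ _ h => Subtype.ext (Subtype.ext h)

theorem inner_gradLp_toL2 (v : H0Div Ω) (φ : testFunctions d) :
    inner ℝ (gradLp Ω φ) (toL2 Ω v) = - inner ℝ (divergence Ω v) (testLp Ω φ) := by
  rw [inner_gradLp, inner_testLp]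
  exact eq_neg_of_add_eq_zero_left (v.2 φ.1 φ.2.1 φ.2.2)

/-- Fields that satisfy Green's formula without boundary term belong to `H₀(div, Ω)`. -/
theorem exists_toL2_eq {v : L2Vec Ω} {g : L2 Ω}
    (h : ∀ φ : testFunctions d, inner ℝ (gradLp Ω φ) v = - inner ℝ g (testLp Ω φ)) :
    ∃ z : H0Div Ω, toL2 Ω z = v ∧ divergence Ω z = g := by
  simp_rw [inner_gradLp, inner_testLp] at h
  have hw : HasWeakDiv Ω v g := fun φ hφ hc _ => h ⟨φ, hφ, hc⟩
  have hg : weakDiv Ω ⟨v, g, hw⟩ = g := (hasWeakDiv_weakDiv Ω ⟨v, g, hw⟩).unique hw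
  refine ⟨⟨⟨v, g, hw⟩, fun φ hφ hc => ?_⟩, rfl, hg⟩
  rw [hg]
  exact add_eq_zero_iff_eq_neg.2 (h ⟨φ, hφ, hc⟩)

/-- The divergence equation is solved by duality: the representer of `gradLp Ω φ ↦ -(g, φ)`
satisfies Green's formula. Since the test functions need not vanish on the boundary of `Ω`, the
formula encodes both the divergence and the zero normal trace. -/
theorem exists_divergence_eq {g : L2 Ω} {K : ℝ} (hK : 0 ≤ K)
    (h : ∀ φ : testFunctions d, |inner ℝ g (testLp Ω φ)| ≤ K * ‖gradLp Ω φ‖) :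
    ∃ z : H0Div Ω, divergence Ω z = g ∧ ‖toL2 Ω z‖ ≤ K := by
  obtain ⟨w, hw, hl⟩ := exists_representer (gradLp Ω)
    (-((innerSL ℝ g).toLinearMap ∘ₗ testLp Ω)) hK (fun φ => by simpa using h φ)
  obtain ⟨z, rfl, hz⟩ := exists_toL2_eq (v := w) (g := g) fun φ => by simpa using hl φ
  exact ⟨z, hz, hw⟩

/-- The divergence of a field with vanishing normal trace has mean zero. -/
theorem divergence_mem_L2Zero (hΩ : Bornology.IsBounded (Ω : Set (Euc d))) (v : H0Div Ω) :
    divergence Ω v ∈ L2Zero Ω := by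
  obtain ⟨R, hR⟩ := hΩ.subset_ball (0 : Euc d)
  -- A bump function equal to `1` on all of `Ω` is admissible in Green's formula, and its gradient
  -- vanishes there.
  let φ : ContDiffBump (0 : Euc d) := ⟨max R 1, max R 1 + 1, by positivity, by linarith⟩
  have hone : ∀ x ∈ (Ω : Set (Euc d)), φ x = 1 := fun x hx =>
    φ.one_of_mem_closedBall (Metric.ball_subset_closedBall
      (Metric.ball_subset_ball (le_max_left _ _) (hR hx)))
  have h := inner_gradLp_toL2 v ⟨φ, φ.contDiff, φ.hasCompactSupport⟩
  rw [inner_gradLp, inner_testLp] at h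
  have h1 : ∫ x in (Ω : Set (Euc d)), fderiv ℝ φ x (toL2 Ω v x) = 0 := by
    rw [setIntegral_congr_fun (g := fun _ => 0) Ω.isOpen.measurableSet, integral_zero]
    intro x hx
    have : (φ : Euc d → ℝ) =ᶠ[𝓝 x] fun _ => 1 := by
      filter_upwards [Ω.isOpen.mem_nhds hx] with y hy using hone y hy
    dsimp only
    rw [this.fderiv_eq]
    simp
  rw [h1] at h
  rw [L2Zero, mem_ofPred_eq, ← setIntegral_congr_fun Ω.isOpen.measurableSet
    (f := fun x => divergence Ω v x * φ x) fun x hx => by simp [hone x hx]]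
  linarith

/-- Poincaré's inequality bounds the pairing with a function of mean zero. -/
theorem HasPoincare.sq_setIntegral_mul_le {S : Set (Euc d)} {C : ℝ} (h : HasPoincare S C)
    (hS : S ⊆ Ω) (hSb : Bornology.IsBounded S) (g : L2 Ω)
    (hg : ∫ x in S, g x = 0) {φ : Euc d → ℝ} (hφ : ContDiff ℝ ∞ φ) :
    (∫ x in S, g x * φ x) ^ 2
      ≤ (∫ x in S, ‖g x‖ ^ 2) * (C * ∫ x in S, ‖fderiv ℝ φ x‖ ^ 2) := by
  obtain ⟨c, hc⟩ := h φ hφ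
  have : IsFiniteMeasure (volume.restrict S) := ⟨by simpa using hSb.measure_lt_top⟩
  have hφc : Continuous φ := hφ.continuous
  have hgS : MemLp (g : Euc d → ℝ) 2 (volume.restrict S) :=
    (Lp.memLp g).mono_measure (Measure.restrict_mono hS le_rfl)
  have hφS : MemLp (fun x => φ x - c) 2 (volume.restrict S) :=
    (memLp_two_iff_integrable_sq (Continuous.aestronglyMeasurable (by fun_prop))).2
      (integrableOn_of_isBounded (by fun_prop) hSb)
  have heq : ∫ x in S, g x * φ x = ∫ x in S, g x * (φ x - c) := by
    have h1 : ∀ x, g x * φ x = g x * (φ x - c) + g x * c := fun x => by ring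
    simp_rw [h1]
    rw [integral_add (f := fun x => g x * (φ x - c)) (hgS.integrable_mul hφS) ((hgS.integrable (by norm_num)).mul_const c),
      integral_mul_const, hg]
    ring
  rw [heq]
  refine (sq_integral_mul_le hgS hφS).trans ?_
  simp_rw [Real.norm_eq_abs, sq_abs]
  refine mul_le_mul_of_nonneg_left ?_ (integral_nonneg fun x => by positivity)
  simpa using hc

/-- Right inverse of the divergence on functions with mean zero. -/
theorem HasPoincare.exists_divergence_eq {C : ℝ} (hΩ : Bornology.IsBounded (Ω : Set (Euc d)))
    (hC : 0 ≤ C) (h : HasPoincare (Ω : Set (Euc d)) C) {g : L2 Ω} (hg : g ∈ L2Zero Ω) :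
    ∃ z : H0Div Ω, divergence Ω z = g ∧ ‖toL2 Ω z‖ ≤ √C * ‖g‖ := by
  refine MixedLOD.exists_divergence_eq (by positivity) fun φ => ?_
  refine abs_le_of_sq_le_sq ?_ (by positivity)
  have := h.sq_setIntegral_mul_le subset_rfl hΩ g hg φ.2.1
  rw [← norm_sq_eq_setIntegral, ← norm_sq_gradLp, ← inner_testLp] at this
  rw [mul_pow, mul_pow, Real.sq_sqrt hC]
  linarith

namespace SimplicialMesh

variable (M : SimplicialMesh Ω)

/-- Right inverse of the divergence on functions with mean zero on all elements. -/
theorem exists_divergence_eq (hΩ : IsBoundedLipschitzDomain Ω) {g : L2 Ω}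
    (hg : ∀ s ∈ M.cells, ∫ x in simplex s ∩ Ω, g x = 0) :
    ∃ z : H0Div Ω, divergence Ω z = g ∧ ‖toL2 Ω z‖ ≤ √(2 ^ d) * M.H * ‖g‖ := by
  have hH := M.H_nonneg
  refine MixedLOD.exists_divergence_eq (by positivity) fun φ => ?_
  have hgφ : IntegrableOn (fun x => g x * φ.1 x) (Ω : Set (Euc d)) :=
    integrable_mul_test g φ.2.1 φ.2.2
  have hc : Continuous (fderiv ℝ φ.1) := φ.2.1.continuous_fderiv (by simp)
  rw [inner_testLp, M.setIntegral_eq_sum hgφ]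
  calc |∑ s ∈ M.cells, ∫ x in simplex s ∩ Ω, g x * φ.1 x|
      ≤ ∑ s ∈ M.cells, |∫ x in simplex s ∩ Ω, g x * φ.1 x| := Finset.abs_sum_le_sum_abs _ _
    -- Since `g` has mean zero on each element, Poincaré's inequality applies elementwise, with
    -- constant `M.H ^ 2 * 2 ^ d`.
    _ ≤ ∑ s ∈ M.cells, √(∫ x in simplex s ∩ Ω, ‖g x‖ ^ 2) *
          √(M.H ^ 2 * 2 ^ d * ∫ x in simplex s ∩ Ω, ‖fderiv ℝ φ.1 x‖ ^ 2) := by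
        refine Finset.sum_le_sum fun s hs => ?_
        rw [← Real.sqrt_mul (integral_nonneg fun x => by positivity)]
        exact Real.abs_le_sqrt ((M.hasPoincare_simplex hΩ hs).sq_setIntegral_mul_le
          inter_subset_right (hΩ.isBounded.subset inter_subset_right) g (hg s hs) φ.2.1)
    _ ≤ √(∑ s ∈ M.cells, ∫ x in simplex s ∩ Ω, ‖g x‖ ^ 2) *
          √(∑ s ∈ M.cells, M.H ^ 2 * 2 ^ d * ∫ x in simplex s ∩ Ω, ‖fderiv ℝ φ.1 x‖ ^ 2) :=
        Real.sum_sqrt_mul_sqrt_le _ (fun s => integral_nonneg fun x => by positivity)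
          fun s => mul_nonneg (by positivity) (integral_nonneg fun x => by positivity)
    _ = √(2 ^ d) * M.H * ‖g‖ * ‖gradLp Ω φ‖ := by
        rw [← Finset.mul_sum, ← M.setIntegral_eq_sum (integrableOn_norm_sq g),
          ← M.setIntegral_eq_sum (integrableOn_of_isBounded (by fun_prop) hΩ.isBounded),
          ← norm_sq_gradLp, ← norm_sq_eq_setIntegral, Real.sqrt_sq (norm_nonneg _),
          Real.sqrt_mul (by positivity), Real.sqrt_mul (by positivity), Real.sqrt_sq hH,
          Real.sqrt_sq (norm_nonneg _)]
        ring

/-- The error of the `L²`-projection onto the piecewise polynomials has mean zero on elements. -/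
theorem setIntegral_sub_projQ (k : ℕ) (f : L2 Ω)
    {s : Finset (Euc d)} (hs : s ∈ M.cells) :
    ∫ x in simplex s ∩ Ω, (f - M.projQ k f : L2 Ω) x = 0 := by
  have hfin : volume.restrict (Ω : Set (Euc d)) (simplex s) ≠ ⊤ :=
    ((Measure.restrict_apply_le _ _).trans_lt (isCompact_simplex s).measure_lt_top).ne
  -- The indicator of an element is a piecewise constant, hence in `M.Q k` for every `k`. Adjacent
  -- elements share boundary points, so it vanishes on the others only almost everywhere.
  set q : L2 Ω := indicatorConstLp 2 (measurableSet_simplex s) hfin 1 with hq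
  have hmem : q ∈ M.Q k := by
    intro t ht
    rcases eq_or_ne t s with rfl | hts
    · refine ⟨1, ?_, ?_⟩
      · rw [MvPolynomial.mem_restrictTotalDegree]; simp
      · filter_upwards [indicatorConstLp_coeFn (p := 2) (hs := measurableSet_simplex t)
          (hμs := hfin) (c := (1 : ℝ))] with x hx hxt
        rw [hq, hx, indicator_of_mem hxt, map_one]
    · refine ⟨0, Submodule.zero_mem _, ?_⟩
      have hdisj : ∀ᵐ x ∂(volume.restrict (Ω : Set (Euc d))), x ∉ simplex t ∩ simplex s :=
        ae_restrict_of_ae (measure_eq_zero_iff_ae_notMem.1 (M.aedisjoint_simplex ht hs hts))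
      filter_upwards [hdisj, indicatorConstLp_coeFn (p := 2) (hs := measurableSet_simplex s)
          (hμs := hfin) (c := (1 : ℝ))] with x hx1 hx hxt
      rw [hq, hx, indicator_of_notMem fun h => hx1 ⟨hxt, h⟩, map_zero]
  have horth : inner ℝ q (f - M.projQ k f) = 0 :=
    Submodule.inner_right_of_mem_orthogonal hmem (Submodule.sub_starProjection_mem_orthogonal f)
  rw [hq, L2.inner_indicatorConstLp_one, Measure.restrict_restrict (measurableSet_simplex s)] at horth
  exact horth

theorem sub_projQ_mem_L2Zero (hΩ : Bornology.IsBounded (Ω : Set (Euc d))) (k : ℕ) (f : L2 Ω) :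
    f - M.projQ k f ∈ L2Zero Ω := by
  have : IsFiniteMeasure (volume.restrict (Ω : Set (Euc d))) :=
    ⟨by simpa using hΩ.measure_lt_top⟩
  rw [L2Zero, mem_ofPred_eq, M.setIntegral_eq_sum ((Lp.memLp _).integrable (by norm_num))]
  exact Finset.sum_eq_zero fun s hs => M.setIntegral_sub_projQ k f hs

end SimplicialMesh

theorem L2Zero_sub_mem (hΩ : Bornology.IsBounded (Ω : Set (Euc d))) {q r : L2 Ω}
    (hq : q ∈ L2Zero Ω) (hr : r ∈ L2Zero Ω) : q - r ∈ L2Zero Ω := by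
  have : IsFiniteMeasure (volume.restrict (Ω : Set (Euc d))) := ⟨by simpa using hΩ.measure_lt_top⟩
  rw [L2Zero, mem_ofPred_eq] at *
  rw [integral_congr_ae (Lp.coeFn_sub q r), ← sub_eq_zero.2 (hq.trans hr.symm)]
  exact integral_sub ((Lp.memLp _).integrable (by norm_num)) ((Lp.memLp _).integrable (by norm_num))

end

section

/-! ### The energy form -/

/-- The Lax-Milgram theorem on a closed subspace. -/
theorem exists_mem_forall_bilin_eq {E : Type*} [NormedAddCommGroup E] [InnerProductSpace ℝ E]
    [CompleteSpace E] {S : Submodule ℝ E} (hS : IsClosed (S : Set E)) (B : LinearMap.BilinForm ℝ E)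
    {α C K : ℝ} (hB : ∀ x y, |B x y| ≤ C * ‖x‖ * ‖y‖) (hα : 0 < α)
    (hc : ∀ x, α * ‖x‖ ^ 2 ≤ B x x) (l : E →ₗ[ℝ] ℝ) (hl : ∀ x, |l x| ≤ K * ‖x‖) :
    ∃ z ∈ S, ∀ w ∈ S, B z w = l w := by
  have : CompleteSpace S := hS.completeSpace_coe
  let B' : S →L[ℝ] S →L[ℝ] ℝ :=
    LinearMap.mkContinuous₂ (B.compl₁₂ S.subtype S.subtype) C fun x y => hB x y
  let L : S →L[ℝ] ℝ := (l ∘ₗ S.subtype).mkContinuous K fun x => hl x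
  have hB' : IsCoercive B' := ⟨α, hα, fun x => by
    rw [mul_assoc, ← pow_two]
    exact hc x⟩
  let z : S := hB'.continuousLinearEquivOfBilin.symm ((InnerProductSpace.toDual ℝ S).symm L)
  refine ⟨z, z.2, fun w hw => ?_⟩
  have h := hB'.continuousLinearEquivOfBilin_apply z ⟨w, hw⟩
  rw [ContinuousLinearEquiv.apply_symm_apply, InnerProductSpace.toDual_symm_apply] at h
  exact h.symm

variable {d : ℕ} {Ω : TopologicalSpace.Opens (Euc d)} {α β : ℝ}
  {A : Euc d → Matrix (Fin d) (Fin d) ℝ}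

theorem aemeasurable_det {X ι : Type*} [MeasurableSpace X] {μ : Measure X} [Fintype ι]
    [DecidableEq ι] {B : X → Matrix ι ι ℝ} (hB : ∀ i j, AEMeasurable (fun x => B x i j) μ) :
    AEMeasurable (fun x => (B x).det) μ := by
  simp_rw [Matrix.det_apply]
  exact Finset.aemeasurable_fun_sum _ fun σ _ =>
    (Finset.aemeasurable_fun_prod _ fun i _ => hB _ _).const_smul _

/-- By Cramer's rule each entry of the inverse is a quotient of determinants. -/
theorem aemeasurable_inv {X ι : Type*} [MeasurableSpace X] {μ : Measure X} [Fintype ι]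
    [DecidableEq ι] {B : X → Matrix ι ι ℝ} (hB : ∀ i j, AEMeasurable (fun x => B x i j) μ)
    (i j : ι) : AEMeasurable (fun x => (B x)⁻¹ i j) μ := by
  simp_rw [Matrix.inv_def, Ring.inverse_eq_inv, Matrix.smul_apply, smul_eq_mul,
    Matrix.adjugate_apply]
  refine (aemeasurable_det hB).inv.mul (aemeasurable_det fun i' j' => ?_)
  simp_rw [Matrix.updateRow_apply]
  split_ifs
  · exact aemeasurable_const
  · exact hB _ _

theorem energyNorm_nonneg (A : Euc d → Matrix (Fin d) (Fin d) ℝ) (v : H0Div Ω) :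
    0 ≤ energyNorm A v := Real.sqrt_nonneg _

namespace IsCoefficient

/-- Nonnegativity of the quadratic form at `ξ + η` and `ξ - η` controls the mixed term. The crude
bound serves only for integrability; the sharp one is Cauchy-Schwarz, in `sq_form_le`. -/
theorem abs_inner_le_ae (hA : IsCoefficient Ω α β A) (hα : 0 < α) :
    ∀ᵐ x ∂(volume.restrict (Ω : Set (Euc d))), ∀ ξ η : Euc d,
      |inner ℝ (Matrix.toEuclideanLin (A x)⁻¹ ξ) η| ≤ β * (‖ξ‖ ^ 2 + ‖η‖ ^ 2) ∧
      inner ℝ (Matrix.toEuclideanLin (A x)⁻¹ ξ) η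
        = inner ℝ (Matrix.toEuclideanLin (A x)⁻¹ η) ξ := by
  filter_upwards [hA.posDef, hA.bounds] with x hx hb ξ η
  have hsymm : (Matrix.toEuclideanLin (A x)⁻¹).IsSymmetric :=
    Matrix.isSymmetric_toEuclideanLin_iff.2 hx.isHermitian.inv
  have h0 : inner ℝ (Matrix.toEuclideanLin (A x)⁻¹ ξ) η
      = inner ℝ (Matrix.toEuclideanLin (A x)⁻¹ η) ξ := by
    rw [hsymm ξ η, real_inner_comm]
  refine ⟨?_, h0⟩
  have hpos : ∀ ζ : Euc d, 0 ≤ inner ℝ (Matrix.toEuclideanLin (A x)⁻¹ ζ) ζ := fun ζ =>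
    (by positivity : 0 ≤ α * ‖ζ‖ ^ 2).trans (hb ζ).1
  have h1 := hpos (ξ + η)
  have h2 := hpos (ξ - η)
  have h3 := hpos ξ
  have h4 := hpos η
  simp only [map_add, map_sub, inner_add_left, inner_add_right, inner_sub_left,
    inner_sub_right] at h1 h2
  rw [abs_le]
  constructor <;> linarith [(hb ξ).2, (hb η).2]

theorem integrableOn_inner (hA : IsCoefficient Ω α β A) (hα : 0 < α) (v w : L2Vec Ω) :
    IntegrableOn (fun x => inner ℝ (Matrix.toEuclideanLin (A x)⁻¹ (v x)) (w x))
      (Ω : Set (Euc d)) := by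
  refine Integrable.mono' (((integrableOn_norm_sq v).add (integrableOn_norm_sq w)).const_mul β)
    (AEMeasurable.aestronglyMeasurable ?_) ?_
  · have hm : ∀ (u : L2Vec Ω) (i : Fin d),
        AEMeasurable (fun x => u x i) (volume.restrict (Ω : Set (Euc d))) := fun u i =>
      ((EuclideanSpace.proj (𝕜 := ℝ) i).continuous.measurable.comp_aemeasurable
        (Lp.aestronglyMeasurable u).aemeasurable)
    have heq : ∀ x, inner ℝ (Matrix.toEuclideanLin (A x)⁻¹ (v x)) (w x)
        = ∑ i, w x i * ∑ j, (A x)⁻¹ i j * v x j := by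
      intro x
      simp [PiLp.inner_apply, Matrix.toLpLin_apply, Matrix.mulVec, dotProduct]
    simp_rw [heq]
    exact Finset.aemeasurable_fun_sum _ fun i _ => (hm w i).mul
      (Finset.aemeasurable_fun_sum _ fun j _ => (aemeasurable_inv hA.aemeasurable i j).mul (hm v j))
  · filter_upwards [hA.abs_inner_le_ae hα] with x hx
    exact (hx _ _).1

/-- The form `(A⁻¹ v, w)_{L²(T)}` on `L²(Ω, ℝᵈ)`. -/
noncomputable def form (hA : IsCoefficient Ω α β A) (hα : 0 < α) (T : Set (Euc d)) :
    LinearMap.BilinForm ℝ (L2Vec Ω) :=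
  LinearMap.mk₂ ℝ
    (fun v w => ∫ x in T ∩ (Ω : Set (Euc d)),
      inner ℝ (Matrix.toEuclideanLin (A x)⁻¹ (v x)) (w x))
    (fun v v' w => by
      rw [← integral_add ((hA.integrableOn_inner hα v w).mono_set inter_subset_right)
        ((hA.integrableOn_inner hα v' w).mono_set inter_subset_right)]
      refine integral_congr_ae ?_
      filter_upwards [ae_restrict_of_ae_restrict_of_subset inter_subset_right
        (Lp.coeFn_add v v')] with x hx
      rw [hx, Pi.add_apply, map_add, inner_add_left])
    (fun c v w => by
      rw [smul_eq_mul, ← integral_const_mul]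
      refine integral_congr_ae ?_
      filter_upwards [ae_restrict_of_ae_restrict_of_subset inter_subset_right
        (Lp.coeFn_smul c v)] with x hx
      rw [hx, Pi.smul_apply, map_smul, real_inner_smul_left])
    (fun v w w' => by
      rw [← integral_add ((hA.integrableOn_inner hα v w).mono_set inter_subset_right)
        ((hA.integrableOn_inner hα v w').mono_set inter_subset_right)]
      refine integral_congr_ae ?_
      filter_upwards [ae_restrict_of_ae_restrict_of_subset inter_subset_right
        (Lp.coeFn_add w w')] with x hx
      rw [hx, Pi.add_apply, inner_add_right])
    (fun c v w => by
      rw [smul_eq_mul, ← integral_const_mul]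
      refine integral_congr_ae ?_
      filter_upwards [ae_restrict_of_ae_restrict_of_subset inter_subset_right
        (Lp.coeFn_smul c w)] with x hx
      rw [hx, Pi.smul_apply, real_inner_smul_right])

variable (hA : IsCoefficient Ω α β A) (hα : 0 < α)

theorem form_symm (T : Set (Euc d)) (v w : L2Vec Ω) : hA.form hα T v w = hA.form hα T w v := by
  refine integral_congr_ae ?_
  filter_upwards [ae_restrict_of_ae_restrict_of_subset inter_subset_right
    (hA.abs_inner_le_ae hα)] with x hx
  exact (hx _ _).2

theorem form_self_nonneg (T : Set (Euc d)) (v : L2Vec Ω) : 0 ≤ hA.form hα T v v := by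
  refine integral_nonneg_of_ae ?_
  filter_upwards [ae_restrict_of_ae_restrict_of_subset inter_subset_right hA.bounds] with x hx
  exact (by positivity : 0 ≤ α * ‖v x‖ ^ 2).trans (hx _).1

theorem form_self_le (T : Set (Euc d)) (v : L2Vec Ω) : hA.form hα T v v ≤ |β| * ‖v‖ ^ 2 := by
  have hint := (integrableOn_norm_sq v).const_mul |β|
  calc hA.form hα T v v ≤ ∫ x in T ∩ (Ω : Set (Euc d)), |β| * ‖v x‖ ^ 2 := by
        refine integral_mono_ae ((hA.integrableOn_inner hα v v).mono_set inter_subset_right)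
          (IntegrableOn.mono_set hint inter_subset_right) ?_
        filter_upwards [ae_restrict_of_ae_restrict_of_subset inter_subset_right
          hA.bounds] with x hx
        exact (hx _).2.trans (by gcongr; exact le_abs_self β)
    _ ≤ ∫ x in (Ω : Set (Euc d)), |β| * ‖v x‖ ^ 2 :=
        setIntegral_mono_set hint (Filter.Eventually.of_forall fun x => by positivity)
          inter_subset_right.eventuallyLE
    _ = |β| * ‖v‖ ^ 2 := by rw [integral_const_mul, norm_sq_eq_setIntegral]

theorem le_form_univ_self (v : L2Vec Ω) : α * ‖v‖ ^ 2 ≤ hA.form hα univ v v := by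
  rw [norm_sq_eq_setIntegral, ← integral_const_mul, form, LinearMap.mk₂_apply, univ_inter]
  refine integral_mono_ae ((integrableOn_norm_sq v).const_mul α) (hA.integrableOn_inner hα v v) ?_
  filter_upwards [hA.bounds] with x hx
  exact (hx _).1

theorem sq_form_le (T : Set (Euc d)) (v w : L2Vec Ω) :
    hA.form hα T v w ^ 2 ≤ hA.form hα T v v * hA.form hα T w w :=
  LinearMap.BilinForm.apply_sq_le_of_symm _ (hA.form_self_nonneg hα T)
    ⟨fun v w => hA.form_symm hα T v w⟩ v w

theorem abs_form_le (T : Set (Euc d)) (v w : L2Vec Ω) :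
    |hA.form hα T v w| ≤ |β| * ‖v‖ * ‖w‖ := by
  refine abs_le_of_sq_le_sq ((hA.sq_form_le hα T v w).trans ?_) (by positivity)
  calc _ ≤ (|β| * ‖v‖ ^ 2) * (|β| * ‖w‖ ^ 2) :=
        mul_le_mul (hA.form_self_le hα T v) (hA.form_self_le hα T w) (hA.form_self_nonneg hα T w)
          (by positivity)
    _ = _ := by ring

/-- The bilinear form `a` on `H₀(div, Ω)`. -/
noncomputable def bilin : LinearMap.BilinForm ℝ (H0Div Ω) :=
  (hA.form hα univ).compl₁₂ (toL2 Ω) (toL2 Ω)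

theorem bilin_apply (v w : H0Div Ω) : hA.bilin hα v w = aForm A v w := by
  change ∫ x in univ ∩ (Ω : Set (Euc d)), _ = _
  rw [univ_inter]
  rfl

theorem energyNorm_sq (v : H0Div Ω) : energyNorm A v ^ 2 = hA.bilin hα v v := by
  rw [energyNorm, ← bilin_apply hA hα, Real.sq_sqrt]
  exact hA.form_self_nonneg hα _ _

theorem energyNorm_le (hA : IsCoefficient Ω α β A) (hα : 0 < α) (v : H0Div Ω) : energyNorm A v ≤ √|β| * ‖toL2 Ω v‖ := by
  refine le_of_sq_le_sq ?_ (by positivity)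
  rw [hA.energyNorm_sq hα, mul_pow, Real.sq_sqrt (abs_nonneg β)]
  exact hA.form_self_le hα _ _

theorem abs_bilin_le (v w : H0Div Ω) : |hA.bilin hα v w| ≤ energyNorm A v * energyNorm A w := by
  refine abs_le_of_sq_le_sq ?_ (mul_nonneg (energyNorm_nonneg A v) (energyNorm_nonneg A w))
  rw [mul_pow, hA.energyNorm_sq hα, hA.energyNorm_sq hα]
  exact hA.sq_form_le hα _ _ _

/-- If `a(v, v) = a(v, w)`, then `v` has at most the energy of `w`. -/
theorem energyNorm_le_of_bilin_eq {v w : H0Div Ω} (h : hA.bilin hα v v = hA.bilin hα v w) :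
    energyNorm A v ≤ energyNorm A w := by
  have h1 := (le_abs_self _).trans (hA.abs_bilin_le hα v w)
  rw [← h, ← hA.energyNorm_sq hα, pow_two] at h1
  rcases (energyNorm_nonneg A v).eq_or_lt with h0 | h0
  · rw [← h0]; exact energyNorm_nonneg A w
  · exact le_of_mul_le_mul_left h1 h0

theorem eq_zero_of_energyNorm_le (hA : IsCoefficient Ω α β A) (hα : 0 < α)
    {v : H0Div Ω} (h : energyNorm A v ≤ 0) : v = 0 := by
  have h0 : energyNorm A v = 0 := le_antisymm h (energyNorm_nonneg A v)
  have h1 : α * ‖toL2 Ω v‖ ^ 2 ≤ energyNorm A v ^ 2 :=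
    (hA.le_form_univ_self hα _).trans_eq (hA.energyNorm_sq hα v).symm
  rw [h0] at h1
  have h4 : ‖toL2 Ω v‖ = 0 := by
    by_contra hne
    have : 0 < ‖toL2 Ω v‖ := lt_of_le_of_ne (norm_nonneg _) (Ne.symm hne)
    nlinarith [mul_pos hα (pow_pos this 2)]
  exact toL2_injective (by rw [norm_eq_zero.1 h4, map_zero])

end IsCoefficient

/-! ### Stability of the quasi-interpolation and the correctors -/

namespace SimplicialMesh.IsStableQuasiInterpolation

variable {M : SimplicialMesh Ω} {k : ℕ} {Cπ : ℝ} {π : H0Div Ω →ₗ[ℝ] H0Div Ω}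

/-- Local stability is summed over the elements, and the bounded overlap of the patches turns it
into a global bound whose constant depends neither on the mesh nor on `k`. -/
theorem norm_sq_le (hπ : M.IsStableQuasiInterpolation k Cπ π) (hd : 0 < d) {γqu γsr : ℝ}
    (hγ : 0 < γqu) (hqu : M.IsQuasiUniform γqu) (hsr : M.IsShapeRegular γsr) (v : H0Div Ω) :
    ‖toL2 Ω (π v)‖ ^ 2 ≤ |Cπ| * |4 * γsr / γqu| ^ d *
      (‖toL2 Ω v‖ ^ 2 + M.H ^ 2 * ‖divergence Ω v‖ ^ 2) := by
  have hpow : (4 * γsr / γqu) ^ d ≤ |4 * γsr / γqu| ^ d := by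
    rw [← abs_pow]; exact le_abs_self _
  have h1 := M.sum_normSqOn_patch_le hd hγ hqu hsr (toL2 Ω v)
  have h2 := M.sum_normSqOn_patch_le hd hγ hqu hsr (divergence Ω v)
  calc ‖toL2 Ω (π v)‖ ^ 2 = ∑ s ∈ M.cells, normSqOn (toL2 Ω (π v)) (simplex s) :=
        (M.sum_normSqOn _).symm
    _ ≤ ∑ s ∈ M.cells, |Cπ| * (normSqOn (toL2 Ω v) (M.patch s)
          + M.H ^ 2 * normSqOn (divergence Ω v) (M.patch s)) := by
        refine Finset.sum_le_sum fun s hs => ?_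
        have h := hπ.stable v s hs
        have h3 := mul_nonneg (sq_nonneg M.H) (normSqOn_nonneg (divergence Ω (π v)) (simplex s))
        have h4 := add_nonneg (normSqOn_nonneg (toL2 Ω v) (M.patch s))
          (mul_nonneg (sq_nonneg M.H) (normSqOn_nonneg (divergence Ω v) (M.patch s)))
        linarith [mul_le_mul_of_nonneg_right (le_abs_self Cπ) h4]
    _ = |Cπ| * ((∑ s ∈ M.cells, normSqOn (toL2 Ω v) (M.patch s))
          + M.H ^ 2 * ∑ s ∈ M.cells, normSqOn (divergence Ω v) (M.patch s)) := by
        rw [Finset.mul_sum, ← Finset.sum_add_distrib, Finset.mul_sum]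
    _ ≤ |Cπ| * (|4 * γsr / γqu| ^ d * ‖toL2 Ω v‖ ^ 2
          + M.H ^ 2 * (|4 * γsr / γqu| ^ d * ‖divergence Ω v‖ ^ 2)) := by
        gcongr
        · exact h1.trans (by gcongr)
        · exact h2.trans (by gcongr)
    _ = _ := by ring

/-- The image of `W_{div 0}` in `L²` is closed. -/
theorem isClosed_map_WDivZero {c : ℝ}
    (hc : ∀ v : H0Div Ω, divergence Ω v = 0 → ‖toL2 Ω (π v)‖ ^ 2 ≤ c * ‖toL2 Ω v‖ ^ 2) :
    IsClosed ((WDivZero π).map (toL2 Ω) : Set (L2Vec Ω)) := by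
  refine isClosed_of_closure_subset fun w hw => ?_
  obtain ⟨y, hy, hyw⟩ := mem_closure_iff_seq_limit.1 hw
  choose z hz hzy using hy
  -- Green's formula with zero divergence is preserved under `L²` limits.
  obtain ⟨v, rfl, hv⟩ := exists_toL2_eq (v := w) (g := 0) fun φ => by
    have h1 : Filter.Tendsto (fun n => inner ℝ (gradLp Ω φ) (y n)) Filter.atTop
        (𝓝 (inner ℝ (gradLp Ω φ) w)) := tendsto_const_nhds.inner hyw
    have h2 : ∀ n, inner ℝ (gradLp Ω φ) (y n) = 0 := fun n => by
      rw [← hzy n, inner_gradLp_toL2, LinearMap.mem_ker.1 (hz n).2, inner_zero_left, neg_zero]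
    simp_rw [h2] at h1
    rw [inner_zero_left, neg_zero]
    exact tendsto_nhds_unique h1 tendsto_const_nhds 
  refine ⟨v, ⟨?_, hv⟩, rfl⟩
  -- On divergence-free fields `π` is bounded in `L²` alone, so `π v` is the limit of `π (z n) = 0`.
  have hle : ∀ n, ‖toL2 Ω (π v)‖ ^ 2 ≤ c * ‖toL2 Ω v - y n‖ ^ 2 := fun n => by
    have h := hc (v - z n) (by rw [map_sub, hv, LinearMap.mem_ker.1 (hz n).2, sub_zero])
    rwa [map_sub, LinearMap.mem_ker.1 (hz n).1, sub_zero, map_sub, hzy n] at h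
  have hlim : Filter.Tendsto (fun n => c * ‖toL2 Ω v - y n‖ ^ 2) Filter.atTop (𝓝 0) := by
    have := ((tendsto_const_nhds (x := toL2 Ω v)).sub hyw).norm.pow 2 |>.const_mul c
    simpa using this
  have h0 : ‖toL2 Ω (π v)‖ ^ 2 ≤ 0 := ge_of_tendsto' hlim hle
  have h1 : toL2 Ω (π v) = 0 := by
    rw [← norm_eq_zero, ← sq_eq_zero_iff]
    exact le_antisymm h0 (by positivity)
  exact LinearMap.mem_ker.2 (toL2_injective (by rw [h1, map_zero]))

end SimplicialMesh.IsStableQuasiInterpolation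

/-! ### The corrector as an energy-orthogonal projection. -/

section Corrector

variable {π : H0Div Ω →ₗ[ℝ] H0Div Ω}

/-- Lax-Milgram is applied in `L²`, where the form is coercive and the image of `WDivZero π` is
closed. So the default value in the definition never occurs. -/
theorem elementCorrector_spec (hA : IsCoefficient Ω α β A) (hα : 0 < α)
    (hW : IsClosed ((WDivZero π).map (toL2 Ω) : Set (L2Vec Ω))) (s : Finset (Euc d))
    (v : H0Div Ω) :
    elementCorrector A π s v ∈ WDivZero π ∧
      ∀ w ∈ WDivZero π, aForm A (elementCorrector A π s v) w = aOn A (simplex s) v w := by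
  have h : ∃ z ∈ WDivZero π, ∀ w ∈ WDivZero π, aForm A z w = aOn A (simplex s) v w := by
    obtain ⟨_, ⟨z, hz, rfl⟩, hzw⟩ := exists_mem_forall_bilin_eq hW (hA.form hα univ)
      (hA.abs_form_le hα univ) hα (hA.le_form_univ_self hα) (hA.form hα (simplex s) (toL2 Ω v))
      (hA.abs_form_le hα (simplex s) _)
    exact ⟨z, hz, fun w hw => (hA.bilin_apply hα z w).symm.trans (hzw _ ⟨w, hw, rfl⟩)⟩
  rw [elementCorrector, dif_pos h]
  exact h.choose_spec

theorem corrector_mem (M : SimplicialMesh Ω) (hA : IsCoefficient Ω α β A) (hα : 0 < α)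
    (hW : IsClosed ((WDivZero π).map (toL2 Ω) : Set (L2Vec Ω))) (v : H0Div Ω) :
    corrector M A π v ∈ WDivZero π :=
  Submodule.sum_mem _ fun s _ => (elementCorrector_spec hA hα hW s v).1

/-- The corrector is the `a`-orthogonal projection onto `W_{div 0}`. -/
theorem bilin_corrector (M : SimplicialMesh Ω) (hA : IsCoefficient Ω α β A) (hα : 0 < α)
    (hW : IsClosed ((WDivZero π).map (toL2 Ω) : Set (L2Vec Ω))) (v : H0Div Ω)
    {w : H0Div Ω} (hw : w ∈ WDivZero π) :
    hA.bilin hα (corrector M A π v) w = hA.bilin hα v w := by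
  rw [corrector, map_sum, LinearMap.sum_apply, hA.bilin_apply hα v w, aForm,
    M.setIntegral_eq_sum (hA.integrableOn_inner hα _ _)]
  refine Finset.sum_congr rfl fun s _ => ?_
  rw [hA.bilin_apply]
  exact (elementCorrector_spec hA hα hW s v).2 w hw

/-- Element correctors are obtained by choice, so linearity is not built in. It follows from
uniqueness: the defect lies in `WDivZero π` and is `a`-orthogonal to itself. -/
theorem corrector_sub (M : SimplicialMesh Ω) (hA : IsCoefficient Ω α β A) (hα : 0 < α)
    (hW : IsClosed ((WDivZero π).map (toL2 Ω) : Set (L2Vec Ω))) (v w : H0Div Ω) :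
    corrector M A π (v - w) = corrector M A π v - corrector M A π w := by
  have hm := corrector_mem M hA hα hW
  set z := corrector M A π (v - w) - (corrector M A π v - corrector M A π w) with hz
  have hzW : z ∈ WDivZero π := sub_mem (hm _) (sub_mem (hm _) (hm _))
  have h0 : hA.bilin hα z z = 0 := by
    nth_rw 1 [hz]
    simp only [map_sub, LinearMap.sub_apply, bilin_corrector M hA hα hW _ hzW]
    ring
  have : z = 0 := hA.eq_zero_of_energyNorm_le hα (by
    rw [energyNorm, ← hA.bilin_apply hα, h0, Real.sqrt_zero])
  exact sub_eq_zero.1 this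

end Corrector

end

section

/-! ### Error analysis of the ideal multiscale method -/

variable {d k : ℕ} {Ω : TopologicalSpace.Opens (Euc d)} {α β Cπ κ : ℝ}
  {A : Euc d → Matrix (Fin d) (Fin d) ℝ} {M : SimplicialMesh Ω} {π : H0Div Ω →ₗ[ℝ] H0Div Ω}
  {f : L2 Ω} {u uH : H0Div Ω} {p pH : L2 Ω}

/-- Only mean-zero functions may be tested with, but the residual `f + divergence Ω u` is itself
one, by the zero normal trace of `u`. -/
theorem IsMixedSolution.divergence_eq (hΩ : Bornology.IsBounded (Ω : Set (Euc d)))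
    (hf : f ∈ L2Zero Ω) (h : IsMixedSolution A f u p) : divergence Ω u = -f := by
  have hq : f - divergence Ω (-u) ∈ L2Zero Ω := L2Zero_sub_mem hΩ hf (divergence_mem_L2Zero hΩ _)
  rw [map_neg, sub_neg_eq_add] at hq
  have h1 := h.mass _ hq
  rw [bForm] at h1
  have h2 : inner ℝ (f + divergence Ω u) (f + divergence Ω u) = (0 : ℝ) := by
    rw [inner_add_left, h1]; ring
  rw [inner_self_eq_zero] at h2
  exact eq_neg_of_add_eq_zero_right h2

theorem SimplicialMesh.projQ_mem (M : SimplicialMesh Ω) (k : ℕ) (f : L2 Ω) : M.projQ k f ∈ M.Q k :=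
  (M.Q k).starProjection_apply_mem f

theorem SimplicialMesh.projQ_eq_self {q : L2 Ω} (hq : q ∈ M.Q k) : M.projQ k q = q :=
  Submodule.starProjection_eq_self_iff.2 hq

theorem SimplicialMesh.inner_projQ (p : L2 Ω) {q : L2 Ω} (hq : q ∈ M.Q k) :
    inner ℝ q (M.projQ k p) = inner ℝ q p := by
  have : inner ℝ q (p - M.projQ k p) = 0 :=
    Submodule.inner_right_of_mem_orthogonal hq (Submodule.sub_starProjection_mem_orthogonal p)
  rw [inner_sub_right] at this
  linarith

theorem sub_mem_Vms (hA : IsCoefficient Ω α β A) (hα : 0 < α)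
    (hW : IsClosed ((WDivZero π).map (toL2 Ω) : Set (L2Vec Ω))) {v w : H0Div Ω}
    (hv : v ∈ Vms M k A π) (hw : w ∈ Vms M k A π) : v - w ∈ Vms M k A π := by
  obtain ⟨v', hv', rfl⟩ := hv
  obtain ⟨w', hw', rfl⟩ := hw
  refine ⟨v' - w', sub_mem hv' hw', ?_⟩
  dsimp only
  rw [corrector_sub M hA hα hW]
  abel

theorem divergence_sub_corrector (hA : IsCoefficient Ω α β A) (hα : 0 < α)
    (hW : IsClosed ((WDivZero π).map (toL2 Ω) : Set (L2Vec Ω))) (v : H0Div Ω) :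
    divergence Ω (v - corrector M A π v) = divergence Ω v := by
  rw [map_sub, LinearMap.mem_ker.1 (corrector_mem M hA hα hW v).2, sub_zero]

theorem SimplicialMesh.IsStableQuasiInterpolation.sub_corrector_mem_Vms
    (hπ : M.IsStableQuasiInterpolation k Cπ π) (v : H0Div Ω) :
    π v - corrector M A π (π v) ∈ Vms M k A π :=
  ⟨π v, hπ.range_eq ▸ LinearMap.mem_range_self π v, rfl⟩

theorem SimplicialMesh.IsStableQuasiInterpolation.divergence_mem_Q
    (hπ : M.IsStableQuasiInterpolation k Cπ π) (hA : IsCoefficient Ω α β A) (hα : 0 < α)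
    (hW : IsClosed ((WDivZero π).map (toL2 Ω) : Set (L2Vec Ω))) {v : H0Div Ω}
    (hv : v ∈ Vms M k A π) : divergence Ω v ∈ M.Q k := by
  obtain ⟨v', hv', rfl⟩ := hv
  rw [← hπ.range_eq] at hv'
  obtain ⟨z, rfl⟩ := hv'
  rw [divergence_sub_corrector hA hα hW, hπ.commuting]
  exact M.projQ_mem k _

theorem IsIdealSolution.divergence_eq (h : IsIdealSolution M k A π f uH pH)
    (hQ : divergence Ω uH ∈ M.Q k) : divergence Ω uH = -M.projQ k f := by
  have hmem : divergence Ω uH + M.projQ k f ∈ M.Q k := add_mem hQ (M.projQ_mem k f)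
  have h1 := h.mass _ hmem
  rw [bForm, real_inner_comm _ f, ← M.inner_projQ f hmem, real_inner_comm _ (divergence Ω uH)] at h1
  have h2 : inner ℝ (divergence Ω uH + M.projQ k f) (divergence Ω uH + M.projQ k f) = (0 : ℝ) := by
    rw [inner_add_right, h1]; ring
  rw [inner_self_eq_zero] at h2
  exact eq_neg_of_add_eq_zero_left h2

/-- Galerkin orthogonality. -/
theorem bilin_sub_eq_zero (hA : IsCoefficient Ω α β A) (hα : 0 < α)
    (hu : IsMixedSolution A f u p) (hH : IsIdealSolution M k A π f uH pH) {v : H0Div Ω}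
    (hv : v ∈ Vms M k A π) (hdiv : divergence Ω v = 0) : hA.bilin hα (u - uH) v = 0 := by
  have h1 := hu.flux v
  have h2 := hH.flux v hv
  rw [bForm, hdiv, inner_zero_left, add_zero, ← hA.bilin_apply hα] at h1 h2
  rw [map_sub, LinearMap.sub_apply, h1, h2, sub_zero]

/-- The ideal multiscale method is a best approximation. -/
theorem energyNorm_sub_le_of_mem_VmsOf (hA : IsCoefficient Ω α β A) (hα : 0 < α)
    (hW : IsClosed ((WDivZero π).map (toL2 Ω) : Set (L2Vec Ω)))
    (hu : IsMixedSolution A f u p) (hH : IsIdealSolution M k A π f uH pH)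
    (hHmem : uH ∈ VmsOf M k A π f) {v : H0Div Ω} (hv : v ∈ VmsOf M k A π f) :
    energyNorm A (u - uH) ≤ energyNorm A (u - v) := by
  have h := bilin_sub_eq_zero hA hα hu hH (sub_mem_Vms hA hα hW hHmem.1 hv.1)
    (by rw [map_sub, hHmem.2, hv.2, sub_self])
  refine hA.energyNorm_le_of_bilin_eq hα ?_
  rw [← sub_add_sub_cancel u uH v, map_add, h, add_zero]

/-- The error of the ideal multiscale interpolation. -/
theorem energyNorm_sub_interpolation_le (hΩ : IsBoundedLipschitzDomain Ω)
    (hA : IsCoefficient Ω α β A) (hα : 0 < α)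
    (hW : IsClosed ((WDivZero π).map (toL2 Ω) : Set (L2Vec Ω)))
    (hπ : M.IsStableQuasiInterpolation k Cπ π) (hκ : 0 ≤ κ)
    (hπκ : ∀ v : H0Div Ω, ‖toL2 Ω (π v)‖ ^ 2
      ≤ κ * (‖toL2 Ω v‖ ^ 2 + M.H ^ 2 * ‖divergence Ω v‖ ^ 2))
    (hf : f ∈ L2Zero Ω) (hu : IsMixedSolution A f u p) :
    energyNorm A (u - (π u - corrector M A π (π u)))
      ≤ √|β| * (√(2 ^ d) + √(κ * (2 ^ d + 1))) * (M.H * ‖f - M.projQ k f‖) := by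
  have hH := M.H_nonneg
  set g := f - M.projQ k f with hg
  set e := u - (π u - corrector M A π (π u)) with he
  have hdu := hu.divergence_eq hΩ.isBounded hf
  have hde : divergence Ω e = -g := by
    rw [he, map_sub, divergence_sub_corrector hA hα hW, hπ.commuting, hdu, map_neg, hg]
    abel
  have hπe : π e = 0 := by
    rw [he, map_sub, map_sub, hπ.idem, LinearMap.mem_ker.1 (corrector_mem M hA hα hW _).1]
    abel
  have heW : ∀ w ∈ WDivZero π, hA.bilin hα e w = 0 := by
    intro w hw
    have h1 := hu.flux w
    rw [bForm, LinearMap.mem_ker.1 hw.2, inner_zero_left, add_zero, ← hA.bilin_apply hα] at h1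
    rw [he]
    simp only [map_sub, LinearMap.sub_apply, bilin_corrector M hA hα hW _ hw, h1, sub_self]
  obtain ⟨z, hz, hzn⟩ := M.exists_divergence_eq hΩ (g := g) fun s hs =>
    M.setIntegral_sub_projQ k f hs
  have hPg : M.projQ k g = 0 := by
    rw [hg, map_sub, M.projQ_eq_self (M.projQ_mem k f), sub_self]
  -- The field `z` compensates the divergence of `e`, and subtracting `π z` returns to the kernel of
  -- `π` without changing the divergence, because `M.projQ k g = 0`.
  have hw : e + (z - π z) ∈ WDivZero π := by
    refine ⟨LinearMap.mem_ker.2 ?_, LinearMap.mem_ker.2 ?_⟩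
    · rw [map_add, hπe, map_sub, hπ.idem, sub_self, add_zero]
    · rw [map_add, hde, map_sub, hπ.commuting, hz, hPg, sub_zero, neg_add_cancel]
  have hle : energyNorm A e ≤ energyNorm A (π z - z) := by
    refine hA.energyNorm_le_of_bilin_eq hα ?_
    have h0 := heW _ hw
    rw [map_add, ← neg_sub (π z) z, map_neg] at h0
    linarith
  have hz2 : ‖toL2 Ω z‖ ≤ √(2 ^ d) * (M.H * ‖g‖) := by rwa [← mul_assoc]
  have hπz : ‖toL2 Ω (π z)‖ ≤ √(κ * (2 ^ d + 1)) * (M.H * ‖g‖) := by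
    refine le_of_sq_le_sq ?_ (by positivity)
    rw [mul_pow, Real.sq_sqrt (by positivity), mul_assoc]
    refine (hπκ z).trans ?_
    gcongr
    rw [hz, add_mul, one_mul, ← mul_pow]
    gcongr
    refine (pow_le_pow_left₀ (norm_nonneg _) hz2 2).trans_eq ?_
    rw [mul_pow, Real.sq_sqrt (by positivity)]
  calc energyNorm A e ≤ √|β| * ‖toL2 Ω (π z - z)‖ := hle.trans (hA.energyNorm_le hα _)
    _ ≤ √|β| * (‖toL2 Ω (π z)‖ + ‖toL2 Ω z‖) := by
        gcongr
        rw [map_sub]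
        exact norm_sub_le _ _
    _ ≤ √|β| * (√(κ * (2 ^ d + 1)) * (M.H * ‖g‖) + √(2 ^ d) * (M.H * ‖g‖)) := by gcongr
    _ = _ := by ring

/-- The inf-sup stability of the ideal multiscale space. -/
theorem exists_mem_Vms_divergence_eq (hΩ : Bornology.IsBounded (Ω : Set (Euc d)))
    (hA : IsCoefficient Ω α β A) (hα : 0 < α)
    (hW : IsClosed ((WDivZero π).map (toL2 Ω) : Set (L2Vec Ω)))
    (hπ : M.IsStableQuasiInterpolation k Cπ π) (hκ : 0 ≤ κ)
    (hπκ : ∀ v : H0Div Ω, ‖toL2 Ω (π v)‖ ^ 2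
      ≤ κ * (‖toL2 Ω v‖ ^ 2 + M.H ^ 2 * ‖divergence Ω v‖ ^ 2))
    {CP : ℝ} (hCP : 0 ≤ CP) (hP : HasPoincare (Ω : Set (Euc d)) CP) {q : L2 Ω}
    (hq : q ∈ M.Q k) (hq0 : q ∈ L2Zero Ω) :
    ∃ v ∈ Vms M k A π, divergence Ω v = q ∧
      energyNorm A v ≤ √|β| * √(κ * (CP + Metric.diam (Ω : Set (Euc d)) ^ 2)) * ‖q‖ := by
  obtain ⟨z, hz, hzn⟩ := hP.exists_divergence_eq hΩ hCP hq0
  refine ⟨π z - corrector M A π (π z), hπ.sub_corrector_mem_Vms z, ?_, ?_⟩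
  · rw [divergence_sub_corrector hA hα hW, hπ.commuting, hz, M.projQ_eq_self hq]
  -- The remainder of an orthogonal projection has at most the energy of the projected field.
  have hle : energyNorm A (π z - corrector M A π (π z)) ≤ energyNorm A (π z) := by
    refine hA.energyNorm_le_of_bilin_eq hα ?_
    have hm := corrector_mem M hA hα hW (π z)
    have h := bilin_corrector M hA hα hW (π z) hm
    simp only [map_sub, LinearMap.sub_apply, h, sub_self, sub_zero]
  refine hle.trans ((hA.energyNorm_le hα _).trans ?_)
  rw [mul_assoc]
  gcongr
  refine le_of_sq_le_sq ?_ (by positivity)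
  rw [mul_pow, Real.sq_sqrt (by positivity), mul_assoc]
  refine (hπκ z).trans ?_
  gcongr
  rw [hz, add_mul]
  gcongr
  · refine (pow_le_pow_left₀ (norm_nonneg _) hzn 2).trans_eq ?_
    rw [mul_pow, Real.sq_sqrt hCP]
  · exact M.H_nonneg
  · exact M.H_le_diam hΩ

/-- The error of the pressure. -/
theorem norm_projQ_sub_le (hΩ : Bornology.IsBounded (Ω : Set (Euc d)))
    (hA : IsCoefficient Ω α β A) (hα : 0 < α) (hu : IsMixedSolution A f u p)
    (hH : IsIdealSolution M k A π f uH pH) {C : ℝ}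
    (hC0 : 0 ≤ C) (hC : ∀ q ∈ M.Q k, q ∈ L2Zero Ω → ∃ v ∈ Vms M k A π, divergence Ω v = q ∧
      energyNorm A v ≤ C * ‖q‖) :
    ‖M.projQ k p - pH‖ ≤ C * energyNorm A (u - uH) := by
  set q := M.projQ k p - pH with hq
  have hqQ : q ∈ M.Q k := sub_mem (M.projQ_mem k p) hH.pressure_mem
  have hq0 : q ∈ L2Zero Ω := by
    have h := L2Zero_sub_mem hΩ (L2Zero_sub_mem hΩ hu.mean_zero hH.mean_zero)
      (M.sub_projQ_mem_L2Zero hΩ k p)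
    convert h using 1
    rw [hq]; abel
  obtain ⟨v, hv, hdv, hvC⟩ := hC q hqQ hq0
  have h1 := hu.flux v
  have h2 := hH.flux v hv
  rw [bForm, hdv, ← hA.bilin_apply hα] at h1 h2
  -- The difference of the two flux equations, tested with the field whose divergence is `q`; since
  -- `q` is in `M.Q k`, `p` may be replaced by its projection.
  have h3 : ‖q‖ * ‖q‖ = - hA.bilin hα (u - uH) v := by
    rw [← real_inner_self_eq_norm_mul_norm]
    nth_rw 2 [hq]
    rw [inner_sub_right, M.inner_projQ p hqQ, map_sub, LinearMap.sub_apply]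
    linarith
  have h4 : ‖q‖ * ‖q‖ ≤ (C * energyNorm A (u - uH)) * ‖q‖ :=
    calc ‖q‖ * ‖q‖ ≤ |hA.bilin hα (u - uH) v| := h3.trans_le (neg_le_abs _)
      _ ≤ energyNorm A (u - uH) * energyNorm A v := hA.abs_bilin_le hα _ _
      _ ≤ energyNorm A (u - uH) * (C * ‖q‖) :=
          mul_le_mul_of_nonneg_left hvC (energyNorm_nonneg A _)
      _ = _ := by ring
  rcases (norm_nonneg q).eq_or_lt with h0 | h0
  · rw [← h0]
    exact mul_nonneg hC0 (energyNorm_nonneg A _)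
  · exact le_of_mul_le_mul_right h4 h0

end

end MixedLOD

/-! ### The uniform constant and the four assertions. -/

theorem theorem3p4 {d : ℕ} (hd : d = 2 ∨ d = 3) (Ω : TopologicalSpace.Opens (Euc d))
    (hΩ : IsBoundedLipschitzDomain Ω) (α β γqu γsr Cπ : ℝ) (hα : 0 < α) (hγqu : 0 < γqu) :
    ∃ C : ℝ, 0 < C ∧
      ∀ (M : SimplicialMesh Ω), M.IsQuasiUniform γqu → M.IsShapeRegular γsr →
      ∀ (k : ℕ) (π : H0Div Ω →ₗ[ℝ] H0Div Ω), M.IsStableQuasiInterpolation k Cπ π →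
      ∀ (A : Euc d → Matrix (Fin d) (Fin d) ℝ), IsCoefficient Ω α β A →
      ∀ f ∈ L2Zero Ω,
      ∀ (u : H0Div Ω) (p : L2 Ω), IsMixedSolution A f u p →
      ∀ (uH : H0Div Ω) (pH : L2 Ω), IsIdealSolution M k A π f uH pH →
        (uH ∈ VmsOf M k A π f ∧
          energyNorm A (u - uH) = ⨅ v : VmsOf M k A π f, energyNorm A (u - v.1) ∧
          energyNorm A (u - uH) ≤ C * (M.H * ‖f - M.projQ k f‖)) ∧
        (‖divergence Ω (u - uH)‖ = ⨅ q : M.Q k, ‖divergence Ω u - q.1‖ ∧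
          ‖divergence Ω (u - uH)‖ = ‖f - M.projQ k f‖) ∧
        ‖p - pH‖ ≤ C * (M.H * ‖f - M.projQ k f‖ + ‖p - M.projQ k p‖) ∧
        (f ∈ M.Q k → u = π u - corrector M A π (π u) ∧ u = uH) := by
  -- The global Poincaré constant is taken from one arbitrary mesh `M₀`, fixed before `M`, so that
  -- it does not depend on `M`. If no mesh exists, there is nothing to prove.
  rcases isEmpty_or_nonempty (SimplicialMesh Ω) with hM | ⟨⟨M₀⟩⟩
  · exact ⟨1, one_pos, fun M => (hM.false M).elim⟩
  have hd0 : 0 < d := by omega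
  obtain ⟨CP, hCP, hP⟩ := M₀.exists_hasPoincare hΩ
  let κ := |Cπ| * |4 * γsr / γqu| ^ d
  have hκ : 0 ≤ κ := by positivity
  let C₁ := √|β| * (√(2 ^ d) + √(κ * (2 ^ d + 1)))
  let C₂ := √|β| * √(κ * (CP + Metric.diam (Ω : Set (Euc d)) ^ 2))
  have hC₁ : 0 ≤ C₁ := by positivity
  have hC₂ : 0 ≤ C₂ := by positivity
  -- `C₁` bounds the flux error, `C₂ * C₁` the error of `pH` against the projected pressure, and `1`
  -- is the coefficient of `‖p - M.projQ k p‖`. The absolute values inside make these nonnegative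
  -- with no sign condition on `β`, `γsr` or `Cπ`.
  refine ⟨C₁ + C₂ * C₁ + 1, by positivity, ?_⟩
  intro M hqu hsr k π hπ A hA f hf u p hu uH pH hH
  have hπκ := hπ.norm_sq_le hd0 hγqu hqu hsr
  have hW : IsClosed ((WDivZero π).map (toL2 Ω) : Set (L2Vec Ω)) :=
    SimplicialMesh.IsStableQuasiInterpolation.isClosed_map_WDivZero (c := κ) fun v hv => by
      simpa [hv] using hπκ v
  have hH0 := M.H_nonneg
  have hdu := hu.divergence_eq hΩ.isBounded hf
  have hduH := hH.divergence_eq (hπ.divergence_mem_Q hA hα hW hH.flux_mem)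
  have hmem : uH ∈ VmsOf M k A π f := ⟨hH.flux_mem, hduH⟩
  have hImem : π u - corrector M A π (π u) ∈ VmsOf M k A π f :=
    ⟨hπ.sub_corrector_mem_Vms u, by
      rw [divergence_sub_corrector hA hα hW, hπ.commuting, hdu, map_neg]⟩
  have hbest : ∀ v ∈ VmsOf M k A π f, energyNorm A (u - uH) ≤ energyNorm A (u - v) := fun v hv =>
    energyNorm_sub_le_of_mem_VmsOf hA hα hW hu hH hmem hv
  have hI := energyNorm_sub_interpolation_le hΩ hA hα hW hπ hκ hπκ hf hu
  have herr : energyNorm A (u - uH) ≤ C₁ * (M.H * ‖f - M.projQ k f‖) := (hbest _ hImem).trans hI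
  have hdiv : divergence Ω (u - uH) = -(f - M.projQ k f) := by
    rw [map_sub, hdu, hduH]; abel
  have hnorm : ‖divergence Ω (u - uH)‖ = ‖f - M.projQ k f‖ := by rw [hdiv, norm_neg]
  refine ⟨⟨hmem, ?_, herr.trans ?_⟩, ⟨?_, hnorm⟩, ?_, fun hfQ => ?_⟩
  · have : Nonempty (VmsOf M k A π f) := ⟨⟨uH, hmem⟩⟩
    exact le_antisymm (le_ciInf fun v => hbest v.1 v.2)
      (ciInf_le ⟨0, by rintro _ ⟨v, rfl⟩; exact energyNorm_nonneg A _⟩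
        (⟨uH, hmem⟩ : VmsOf M k A π f))
  · gcongr
    nlinarith [mul_nonneg hC₂ hC₁]
  -- Since `div u = -f`, the minimality of the projection of `f` is transported by `q ↦ -q`.
  · rw [hnorm, hdu, SimplicialMesh.projQ, Submodule.starProjection_minimal]
    refine (Equiv.neg (M.Q k)).iInf_congr fun q => ?_
    rw [Equiv.neg_apply, Submodule.coe_neg, sub_neg_eq_add, neg_add_eq_sub, norm_sub_rev]
  · have hinf := norm_projQ_sub_le hΩ.isBounded hA hα hu hH hC₂ fun q hq hq0 =>
      exists_mem_Vms_divergence_eq hΩ.isBounded hA hα hW hπ hκ hπκ hCP hP hq hq0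
    have h1 : ‖M.projQ k p - pH‖ ≤ C₂ * (C₁ * (M.H * ‖f - M.projQ k f‖)) :=
      hinf.trans (mul_le_mul_of_nonneg_left herr hC₂)
    have h2 := norm_sub_le_norm_sub_add_norm_sub p (M.projQ k p) pH
    have h3 : 0 ≤ M.H * ‖f - M.projQ k f‖ := by positivity
    have h4 := norm_nonneg (p - M.projQ k p)
    nlinarith [mul_nonneg hC₁ h3, mul_nonneg hC₁ h4, mul_nonneg (mul_nonneg hC₂ hC₁) h4]
  · rw [M.projQ_eq_self hfQ, sub_self, norm_zero, mul_zero, mul_zero] at hI herr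
    exact ⟨sub_eq_zero.1 (hA.eq_zero_of_energyNorm_le hα hI),
      sub_eq_zero.1 (hA.eq_zero_of_energyNorm_le hα herr)⟩
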